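/- For $r\in\mathbb R$ put $\langle r\rangle=\sqrt{1+r^2}$, and for $\xi\in\mathbb R^d$ put $\langle\xi\rangle=\langle|\xi|\rangle$ and $\|\xi\|=\sum_{i=1}^d|\xi_i|$. For $\sigma\ge 0$, $s,b\in\mathbb R$ and a continuous function $h:\mathbb R^d\to\mathbb R$, let $X_h^{\sigma,s,b}=X_h^{\sigma,s,b}(\mathbb R^{1+d})$ be the space of tempered distributions $f$ on $\mathbb R^{1+d}$ whose space-time Fourier transform $\widehat f(\tau,\xi)=\int_{\mathbb R^{1+d}}e^{-i(t\tau+x\cdot\xi)}f(t,x)\,dt\,dx$ is a function with $$\|f\|_{X_h^{\sigma,s,b}}=\big\|e^{\sigma\|\xi\|}\langle\xi\rangle^s\langle\tau-h(\xi)\rangle^b\widehat f(\tau,\xi)\big\|_{L^2_{\tau,\xi}}<\infty .$$ Write $X^{\sigma,s,b}$ when $h(\xi)=-|\xi|^2$ and $X_\pm^{\sigma,s,b}$ when $h(\xi)=\mp|\xi|$. Let $d\in\{1,2,3\}$, $s>-1/2$ and $$\tfrac12<b\le b'<\min\Big\{\frac{6+2s-d}{4},\,1,\,s+1\Big\}.$$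 Then there is a constant $C>0$, depending only on $d,s,b,b'$, such that for every $\sigma>0$ and for each choice of sign $\pm$: 1. for all $f\in X^{\sigma,0,b}$ and $g\in X_\pm^{\sigma,s,b}$, the distributions $f$ and $g$ are functions, their product $fg$ is a tempered distribution, and $$\|fg\|_{X^{\sigma,0,b'-1}}\le C\,\|f\|_{X^{\sigma,0,b}}\,\|g\|_{X_\pm^{\sigma,s,b}};$$ 2. for all $f,g\in X^{\sigma,0,b}$, the distributions $f$ and $g$ are functions, $f\bar g$ is a tempered distribution, and $$\|f\bar g\|_{X_\pm^{\sigma,-s,b'-1}}\le C\,\|f\|_{X^{\sigma,0,b}}\,\|g\|_{X^{\sigma,0,b}}.$$ -/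

import Mathlib

open MeasureTheory FourierTransform
open scoped SchwartzMap ENNReal

noncomputable section

namespace GevreyBourgain

/-- Space-time `ℝ^{1+d}`, used both for the variables `(t, x)` and for the dual variables `(τ, ξ)`:
coordinate `0` is the time (frequency), the other `d` coordinates are the space (frequency). -/
abbrev SpaceTime (d : ℕ) : Type := EuclideanSpace ℝ (Fin (d + 1))

/-- The time frequency `τ` of `ζ = (τ, ξ)`. -/
def timePart {d : ℕ} (ζ : SpaceTime d) : ℝ := ζ 0

/-- The space frequency `ξ` of `ζ = (τ, ξ)`. -/
def spacePart {d : ℕ} (ζ : SpaceTime d) : EuclideanSpace ℝ (Fin d) :=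
  WithLp.toLp 2 fun i => ζ i.succ

/-- The Japanese bracket `⟨r⟩ = √(1 + r²)`. -/
def bracket (r : ℝ) : ℝ := Real.sqrt (1 + r ^ 2)

/-- The weight `e^{σ‖ξ‖₁} ⟨ξ⟩^s ⟨τ - h(ξ)⟩^b` where `‖ξ‖₁ = ∑ |ξ_i|`. -/
def weight {d : ℕ} (h : EuclideanSpace ℝ (Fin d) → ℝ) (σ s b : ℝ) (ζ : SpaceTime d) : ℝ :=
  Real.exp (σ * ∑ i, |spacePart ζ i|) * bracket ‖spacePart ζ‖ ^ s *
    bracket (timePart ζ - h (spacePart ζ)) ^ b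

/-- The tempered distribution `u` is (integration against) the function `f`. -/
def IsFunction {d : ℕ} (f : SpaceTime d → ℂ) (u : 𝓢'(SpaceTime d, ℂ)) : Prop :=
  ∀ φ : 𝓢(SpaceTime d, ℂ),
    Integrable (fun z => φ z * f z) volume ∧ u φ = ∫ z, φ z * f z

/-- The Gevrey-Bourgain norm
`‖e^{σ‖ξ‖₁} ⟨ξ⟩^s ⟨τ - h(ξ)⟩^b û(τ, ξ)‖_{L²}` of a tempered distribution `u`, equal to `∞` if the
Fourier transform of `u` is not a function.  Here `û(ζ) = ∫ e^{-i z·ζ} u(z) dz`; since Mathlib's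
`𝓕 u` has the kernel `e^{-2πi z·ζ}`, `û(ζ)` is `𝓕 u` at `ζ / (2π)`.  The function `G` representing
`𝓕 u` is unique up to null sets, so that the infimum is over a single value or empty. -/
def gbNorm {d : ℕ} (h : EuclideanSpace ℝ (Fin d) → ℝ) (σ s b : ℝ) (u : 𝓢'(SpaceTime d, ℂ)) :
    ℝ≥0∞ :=
  ⨅ (G : SpaceTime d → ℂ) (_ : IsFunction G (𝓕 u)),
    eLpNorm (fun ζ => (weight h σ s b ζ : ℂ) * G ((2 * Real.pi)⁻¹ • ζ)) 2 volume

/-- The Schrödinger phase `h(ξ) = -|ξ|²`. -/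
def schrodinger {d : ℕ} (ξ : EuclideanSpace ℝ (Fin d)) : ℝ := -‖ξ‖ ^ 2

/-- The phase `h(ξ) = -ε|ξ|`; with `ε = 1` and `ε = -1` these are the phases `∓|ξ|` of the
`±`-spaces. -/
def wave {d : ℕ} (ε : ℝ) (ξ : EuclideanSpace ℝ (Fin d)) : ℝ := -(ε * ‖ξ‖)

/-- `w` is the product `u v`: `u`, `v` are functions `f`, `g` and `w` is the pointwise product
`f g`. -/
def IsProduct {d : ℕ} (u v w : 𝓢'(SpaceTime d, ℂ)) : Prop :=
  ∃ f g : SpaceTime d → ℂ, IsFunction f u ∧ IsFunction g v ∧ IsFunction (fun z => f z * g z) w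

/-- `w` is the product of `u` and the complex conjugate of `v`. -/
def IsConjProduct {d : ℕ} (u v w : 𝓢'(SpaceTime d, ℂ)) : Prop :=
  ∃ f g : SpaceTime d → ℂ, IsFunction f u ∧ IsFunction g v ∧
    IsFunction (fun z => f z * (starRingEnd ℂ) (g z)) w

end GevreyBourgain

end

open GevreyBourgain

/-!
The Gevrey weight is submultiplicative, `e^{σ‖ξ + η‖₁} ≤ e^{σ‖ξ‖₁} e^{σ‖η‖₁}`, so on the Fourier
side both estimates follow, uniformly in `σ`, from an `L²` bound for one trilinear form with the
weights `⟨ξ⟩^(-s) ⟨τ - h(ξ)⟩^(-b)`. Two instances of that bound come from Cauchy-Schwarz. If one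
modulation is left without weight, one needs `∫ ⟨A + |y - q|² + φ(y)⟩^(-2β) ⟨y⟩^(-2m) dy` to be
bounded uniformly in `A`, `q` and in `φ` with a given Lipschitz constant, which holds for `m ≥ 0`
with `2m > d - 2`. If all three modulations have a weight with exponent `β > 1/2`, the difference
of two Schrödinger phases is affine, `|y + x|² - |y|² = 2 x·y + |x|²`, and integrating along `x`
gains the factor `|x|^(1/2)`. Interpolation between the two with `θ = (1 - b') / β` and `β` close
to `1/2` gives the whole range of exponents.
-/

noncomputable section

namespace GevreyBourgain

open Set Metric Module Filter
open scoped NNReal Topology Convolution ComplexConjugate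

section Decay

lemma bracket_pos (x : ℝ) : 0 < bracket x := Real.sqrt_pos.2 (by positivity)

lemma one_le_bracket (x : ℝ) : 1 ≤ bracket x := Real.one_le_sqrt.2 (by nlinarith [sq_nonneg x])

@[fun_prop]
lemma continuous_bracket : Continuous bracket := by unfold bracket; fun_prop

/-- The power `⟨x⟩^(-p)` of the Japanese bracket, with values in `ℝ≥0∞` for use in Lebesgue
integrals. -/
def decay (p x : ℝ) : ℝ≥0∞ := ENNReal.ofReal (bracket x ^ (-p))

@[fun_prop]
lemma measurable_decay (p : ℝ) : Measurable (decay p) :=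
  (ENNReal.continuous_ofReal.comp
    (continuous_bracket.rpow_const fun x => Or.inl (bracket_pos x).ne')).measurable

@[simp]
lemma decay_zero (x : ℝ) : decay 0 x = 1 := by simp [decay]

lemma decay_mul_decay (p q x : ℝ) : decay p x * decay q x = decay (p + q) x := by
  rw [decay, decay, ← ENNReal.ofReal_mul (Real.rpow_nonneg (bracket_pos x).le _),
    ← Real.rpow_add (bracket_pos x), decay, neg_add]

lemma decay_sq (p x : ℝ) : decay p x ^ 2 = decay (2 * p) x := by
  rw [sq, decay_mul_decay, two_mul]

lemma decay_rpow (p x θ : ℝ) : decay p x ^ θ = decay (θ * p) x := by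
  rw [decay, ENNReal.ofReal_rpow_of_pos (Real.rpow_pos_of_pos (bracket_pos x) _),
    ← Real.rpow_mul (bracket_pos x).le, decay]
  congr 2
  ring

lemma decay_le_decay_of_le {p q : ℝ} (h : p ≤ q) (x : ℝ) : decay q x ≤ decay p x :=
  ENNReal.ofReal_le_ofReal (Real.rpow_le_rpow_of_exponent_le (one_le_bracket x) (by linarith))

lemma decay_le_one {p : ℝ} (hp : 0 ≤ p) (x : ℝ) : decay p x ≤ 1 :=
  (decay_le_decay_of_le hp x).trans_eq (decay_zero x)

lemma decay_le_decay_of_abs_le {p x y : ℝ} (hp : 0 ≤ p) (h : |x| ≤ |y|) :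
    decay p y ≤ decay p x :=
  ENNReal.ofReal_le_ofReal (Real.rpow_le_rpow_of_nonpos (bracket_pos x)
    (Real.sqrt_le_sqrt (by linarith [sq_le_sq.2 h])) (by linarith))

lemma decay_neg (p x : ℝ) : decay p (-x) = decay p x := by simp only [decay, bracket, neg_sq]

lemma lintegral_decay_norm_lt_top {E : Type*} [NormedAddCommGroup E] [NormedSpace ℝ E]
    [FiniteDimensional ℝ E] [MeasurableSpace E] [BorelSpace E] (μ : Measure E) [μ.IsAddHaarMeasure]
    {p : ℝ} (hp : finrank ℝ E < p) : ∫⁻ y, decay p ‖y‖ ∂μ < ⊤ := by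
  refine lt_of_eq_of_lt (lintegral_congr fun y => ?_)
    (integrable_rpow_neg_one_add_norm_sq (μ := μ) hp).lintegral_lt_top
  rw [decay, bracket, Real.sqrt_eq_rpow, ← Real.rpow_mul (by positivity)]
  congr 2
  ring

lemma lintegral_decay_lt_top {p : ℝ} (hp : 1 < p) : ∫⁻ x, decay p x < ⊤ := by
  simpa [decay, bracket] using lintegral_decay_norm_lt_top (volume : Measure ℝ) (p := p)
    (by simpa using hp)

end Decay

section Quadratic

lemma lintegral_comp_le_of_antilipschitz {φ : ℝ → ℝ} {K : ℝ≥0} (h : AntilipschitzWith K φ)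
    (hφ : Measurable φ) {f : ℝ → ℝ≥0∞} (hf : Measurable f) :
    ∫⁻ u, f (φ u) ≤ K * ∫⁻ x, f x := by
  have hmap : Measure.map φ volume ≤ (K : ℝ≥0∞) • (volume : Measure ℝ) := by
    refine Measure.le_iff.2 fun s hs => ?_
    have := h.hausdorffMeasure_preimage_le (d := 1) zero_le_one s
    simpa [Measure.map_apply hφ hs, hausdorffMeasure_real] using this
  calc ∫⁻ u, f (φ u) = ∫⁻ x, f x ∂(Measure.map φ volume) := (lintegral_map hf hφ).symm
    _ ≤ ∫⁻ x, f x ∂((K : ℝ≥0∞) • volume) := lintegral_mono' hmap le_rfl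
    _ = K * ∫⁻ x, f x := by rw [lintegral_smul_measure, smul_eq_mul]

lemma abs_sqrt_max_sub_sqrt_max_le {R : ℝ} (hR : 0 < R) (u v : ℝ) :
    R * |√(max u (R ^ 2)) - √(max v (R ^ 2))| ≤ |u - v| / 2 := by
  set a := √(max u (R ^ 2)) with ha
  set b := √(max v (R ^ 2)) with hb
  have hRa : R ≤ a := Real.le_sqrt_of_sq_le (le_max_right _ _)
  have hRb : R ≤ b := Real.le_sqrt_of_sq_le (le_max_right _ _)
  have hab : max u (R ^ 2) - max v (R ^ 2) = (a - b) * (a + b) := by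
    rw [← Real.sq_sqrt (show 0 ≤ max u (R ^ 2) by positivity),
      ← Real.sq_sqrt (show 0 ≤ max v (R ^ 2) by positivity), ← ha, ← hb]
    ring
  have hmax := abs_max_sub_max_le_abs u v (R ^ 2)
  rw [hab, abs_mul, abs_of_pos (show 0 < a + b by linarith)] at hmax
  nlinarith [abs_nonneg (a - b)]

lemma antilipschitzWith_add_comp_sqrt_max {R : ℝ≥0} (hR : 0 < R) {g : ℝ → ℝ}
    (hg : LipschitzWith R g) (A : ℝ) :
    AntilipschitzWith 2 fun u => A + u + g √(max u ((R : ℝ) ^ 2)) := by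
  refine AntilipschitzWith.of_le_mul_dist fun u v => ?_
  have hgR := (hg.dist_le_mul √(max u ((R : ℝ) ^ 2)) √(max v ((R : ℝ) ^ 2))).trans
    (abs_sqrt_max_sub_sqrt_max_le hR u v)
  rw [Real.dist_eq] at hgR
  have htri := abs_sub (A + u + g √(max u ((R : ℝ) ^ 2)) - (A + v + g √(max v ((R : ℝ) ^ 2))))
    (g √(max u ((R : ℝ) ^ 2)) - g √(max v ((R : ℝ) ^ 2)))
  rw [show A + u + g √(max u ((R : ℝ) ^ 2)) - (A + v + g √(max v ((R : ℝ) ^ 2))) -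
    (g √(max u ((R : ℝ) ^ 2)) - g √(max v ((R : ℝ) ^ 2))) = u - v by ring] at htri
  rw [Real.dist_eq, Real.dist_eq, NNReal.coe_ofNat]
  linarith

/-- The substitution `u = r²` turns the phase into `A + u + g(√u)`, which is expanding for `u > R²`
because `g ∘ √` is `1/2`-Lipschitz there. -/
lemma setLIntegral_Ioi_mul_comp_sq_add_le {R : ℝ≥0} (hR : 0 < R) {g : ℝ → ℝ}
    (hg : LipschitzWith R g) (A : ℝ) {f : ℝ → ℝ≥0∞} (hf : Measurable f) :
    ∫⁻ r in Ioi (R : ℝ), ENNReal.ofReal r * f (A + r ^ 2 + g r) ≤ ∫⁻ x, f x := by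
  set φ : ℝ → ℝ := fun u => A + u + g √(max u ((R : ℝ) ^ 2))
  have hgc := hg.continuous
  have hφ : Measurable φ := by
    apply Continuous.measurable
    fun_prop
  have hpos : ∀ r ∈ Ioi (R : ℝ), 0 < r := fun r hr => R.coe_nonneg.trans_lt hr
  have hcomp : ∀ r ∈ Ioi (R : ℝ),
      2 * (ENNReal.ofReal r * f (A + r ^ 2 + g r)) = ENNReal.ofReal |2 * r| * f (φ (r ^ 2)) := by
    intro r hr
    have hr0 := hpos r hr
    have hsqrt : √(max (r ^ 2) ((R : ℝ) ^ 2)) = r := by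
      rw [max_eq_left (pow_le_pow_left₀ R.coe_nonneg (le_of_lt hr) 2), Real.sqrt_sq hr0.le]
    simp only [φ, hsqrt]
    rw [abs_of_pos (by positivity), ENNReal.ofReal_mul two_pos.le, mul_assoc, ENNReal.ofReal_ofNat]
  have hinj : InjOn (fun r : ℝ => r ^ 2) (Ioi (R : ℝ)) := fun x hx y hy =>
    (pow_left_inj₀ (hpos x hx).le (hpos y hy).le two_ne_zero).1
  have htwo : 2 * ∫⁻ r in Ioi (R : ℝ), ENNReal.ofReal r * f (A + r ^ 2 + g r) ≤
      2 * ∫⁻ x, f x := calc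
    _ = ∫⁻ r in Ioi (R : ℝ), ENNReal.ofReal |2 * r| * f (φ (r ^ 2)) := by
      rw [← lintegral_const_mul _ (by fun_prop)]
      exact setLIntegral_congr_fun measurableSet_Ioi hcomp
    _ = ∫⁻ u in (fun r : ℝ => r ^ 2) '' Ioi (R : ℝ), f (φ u) :=
      (lintegral_image_eq_lintegral_abs_deriv_mul measurableSet_Ioi
        (fun r _ => by simpa using (hasDerivAt_pow 2 r).hasDerivWithinAt) hinj
        fun u => f (φ u)).symm
    _ ≤ ∫⁻ u, f (φ u) := setLIntegral_le_lintegral _ _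
    _ ≤ 2 * ∫⁻ x, f x :=
      lintegral_comp_le_of_antilipschitz (antilipschitzWith_add_comp_sqrt_max hR hg A) hφ hf
  exact (ENNReal.mul_le_mul_iff_right two_ne_zero ENNReal.ofNat_ne_top).1 htwo

variable {E : Type*} [NormedAddCommGroup E] [NormedSpace ℝ E] [FiniteDimensional ℝ E]
  [MeasurableSpace E] [BorelSpace E]

lemma setLIntegral_compl_zero_eq_lintegral_sphere (μ : Measure E) [μ.IsAddHaarMeasure]
    {f : E → ℝ≥0∞} (hf : Measurable f) :
    ∫⁻ y in {0}ᶜ, f y ∂μ = ∫⁻ ω : sphere (0 : E) 1, (∫⁻ r in Ioi (0 : ℝ),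
      ENNReal.ofReal (r ^ (finrank ℝ E - 1)) * f (r • (ω : E))) ∂μ.toSphere := by
  have hpolar := μ.measurePreserving_homeomorphUnitSphereProd.lintegral_comp_emb
    (Homeomorph.measurableEmbedding _)
    (fun z : sphere (0 : E) 1 × Ioi (0 : ℝ) => f (z.2.1 • z.1.1))
  have hinv : ∀ y : ({0}ᶜ : Set E), (homeomorphUnitSphereProd E y).2.1 •
      (homeomorphUnitSphereProd E y).1.1 = y := fun y => by
    simp [smul_smul, norm_ne_zero_iff.2 y.2]
  simp only [hinv] at hpolar
  rw [← lintegral_subtype_comap (measurableSet_singleton _).compl, hpolar,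
    lintegral_prod _ (by fun_prop)]
  refine lintegral_congr fun ω => ?_
  rw [Measure.volumeIoiPow, lintegral_withDensity_eq_lintegral_mul _ (by fun_prop) (by fun_prop)]
  exact lintegral_subtype_comap measurableSet_Ioi
    fun r : ℝ => ENNReal.ofReal (r ^ (finrank ℝ E - 1)) * f (r • (ω : E))

lemma setLIntegral_compl_closedBall_comp_normSq_add_le (hE : finrank ℝ E ≤ 2) (μ : Measure E)
    [μ.IsAddHaarMeasure] {R : ℝ≥0} (hR : 1 ≤ R) {φ : E → ℝ} (hφ : LipschitzWith R φ) (A : ℝ)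
    {f : ℝ → ℝ≥0∞} (hf : Measurable f) :
    ∫⁻ y in (closedBall (0 : E) R)ᶜ, f (A + ‖y‖ ^ 2 + φ y) ∂μ ≤
      μ.toSphere univ * ∫⁻ x, f x := by
  have hφc := hφ.continuous
  have hmeas : MeasurableSet (closedBall (0 : E) R)ᶜ := measurableSet_closedBall.compl
  set F : E → ℝ≥0∞ := (closedBall (0 : E) R)ᶜ.indicator fun y => f (A + ‖y‖ ^ 2 + φ y)
  have hF : Measurable F := Measurable.indicator (by fun_prop) hmeas
  have hsupp : F.support ⊆ {0}ᶜ := fun y hy h0 =>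
    mem_of_indicator_ne_zero hy (by simp [mem_singleton_iff.1 h0])
  have hray : ∀ ω : sphere (0 : E) 1, ∫⁻ r in Ioi (0 : ℝ),
      ENNReal.ofReal (r ^ (finrank ℝ E - 1)) * F (r • (ω : E)) ≤ ∫⁻ x, f x := by
    intro ω
    have hφω : LipschitzWith R fun r : ℝ => φ (r • (ω : E)) :=
      LipschitzWith.of_dist_le_mul fun r r' => (hφ.dist_le_mul _ _).trans_eq <| by
        simp [dist_eq_norm, ← sub_smul, norm_smul]
    refine le_trans ?_ (setLIntegral_Ioi_mul_comp_sq_add_le (one_pos.trans_le hR) hφω A hf)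
    rw [← lintegral_indicator measurableSet_Ioi, ← lintegral_indicator measurableSet_Ioi]
    refine lintegral_mono fun r => indicator_le' (fun r hr => ?_) (fun _ _ => zero_le) r
    have hnorm : ‖r • (ω : E)‖ = r := by simp [norm_smul, abs_of_pos (mem_Ioi.1 hr)]
    by_cases hRr : r ∈ Ioi (R : ℝ)
    · have hmem : r • (ω : E) ∈ (closedBall (0 : E) R)ᶜ := by simpa [hnorm] using hRr
      simp only [F, indicator_of_mem hRr, indicator_of_mem hmem, hnorm]
      gcongr
      exact (pow_le_pow_right₀ ((NNReal.one_le_coe.2 hR).trans (le_of_lt hRr))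
        (by omega)).trans_eq (pow_one r)
    · have hmem : r • (ω : E) ∉ (closedBall (0 : E) R)ᶜ := by simpa [hnorm] using hRr
      simp only [F, indicator_of_notMem hmem, mul_zero, zero_le]
  calc _ = ∫⁻ y in {0}ᶜ, F y ∂μ := by
        rw [← lintegral_indicator hmeas, setLIntegral_eq_of_support_subset hsupp]
    _ ≤ ∫⁻ _ : sphere (0 : E) 1, (∫⁻ x, f x) ∂μ.toSphere := by
        rw [setLIntegral_compl_zero_eq_lintegral_sphere μ hF]
        exact lintegral_mono hray
    _ = μ.toSphere univ * ∫⁻ x, f x := by rw [lintegral_const, mul_comm]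

lemma exists_lintegral_decay_quadratic_le (hE : finrank ℝ E ≤ 2) (μ : Measure E)
    [μ.IsAddHaarMeasure] {p : ℝ} (hp : 1 < p) (K : ℝ≥0) :
    ∃ C : ℝ≥0, ∀ φ : E → ℝ, LipschitzWith K φ → ∀ (A : ℝ) (q : E),
      ∫⁻ y, decay p (A + ‖y - q‖ ^ 2 + φ y) ∂μ ≤ C := by
  set C : ℝ≥0∞ := μ (closedBall 0 ↑(K + 1)) + μ.toSphere univ * ∫⁻ x, decay p x
  have hC : C ≠ ⊤ := ENNReal.add_ne_top.2 ⟨measure_closedBall_lt_top.ne,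
    ENNReal.mul_ne_top (measure_ne_top _ _) (lintegral_decay_lt_top hp).ne⟩
  refine ⟨C.toNNReal, fun φ hφ A q => (ENNReal.coe_toNNReal hC).symm ▸ ?_⟩
  have hφq : LipschitzWith (K + 1) fun y => φ (y + q) := by
    refine LipschitzWith.of_dist_le_mul fun x y => ?_
    simpa using (hφ.weaken (le_add_of_nonneg_right zero_le_one)).dist_le_mul (x + q) (y + q)
  calc ∫⁻ y, decay p (A + ‖y - q‖ ^ 2 + φ y) ∂μ
      = ∫⁻ y, decay p (A + ‖y‖ ^ 2 + φ (y + q)) ∂μ := by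
        rw [← lintegral_add_right_eq_self _ q]
        simp only [add_sub_cancel_right]
    _ = ∫⁻ y in closedBall 0 ↑(K + 1), decay p (A + ‖y‖ ^ 2 + φ (y + q)) ∂μ +
        ∫⁻ y in (closedBall 0 ↑(K + 1))ᶜ, decay p (A + ‖y‖ ^ 2 + φ (y + q)) ∂μ :=
      (lintegral_add_compl _ measurableSet_closedBall).symm
    _ ≤ C := by
      refine add_le_add ?_ (setLIntegral_compl_closedBall_comp_normSq_add_le hE μ
        (le_add_of_nonneg_left K.2) hφq A (measurable_decay p))
      exact (lintegral_mono fun y => decay_le_one (one_pos.trans hp).le _).trans_eq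
        (setLIntegral_one _)

end Quadratic

section Slicing

variable {n : ℕ}

/-- The point of `ℝ^{1+n}` with time coordinate `t` and space coordinates `x`. -/
def consTime (t : ℝ) (x : EuclideanSpace ℝ (Fin n)) : SpaceTime n :=
  WithLp.toLp 2 (Fin.cons t x)

@[simp]
lemma timePart_consTime (t : ℝ) (x : EuclideanSpace ℝ (Fin n)) :
    timePart (consTime t x) = t := by
  simp [timePart, consTime]

@[simp]
lemma spacePart_consTime (t : ℝ) (x : EuclideanSpace ℝ (Fin n)) :
    spacePart (consTime t x) = x := by
  ext i
  simp [spacePart, consTime]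

lemma timePart_add (y z : SpaceTime n) : timePart (y + z) = timePart y + timePart z := rfl

lemma spacePart_add (y z : SpaceTime n) : spacePart (y + z) = spacePart y + spacePart z := rfl

lemma timePart_sub (y z : SpaceTime n) : timePart (y - z) = timePart y - timePart z := rfl

lemma spacePart_sub (y z : SpaceTime n) : spacePart (y - z) = spacePart y - spacePart z := rfl

lemma norm_sq_eq_timePart_add_spacePart (y : SpaceTime n) :
    ‖y‖ ^ 2 = timePart y ^ 2 + ‖spacePart y‖ ^ 2 := by
  simp [EuclideanSpace.norm_sq_eq, timePart, spacePart, Fin.sum_univ_succ]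

lemma abs_timePart_le_norm (y : SpaceTime n) : |timePart y| ≤ ‖y‖ := PiLp.norm_apply_le y 0

lemma lipschitzWith_consTime (t : ℝ) :
    LipschitzWith 1 (consTime t : EuclideanSpace ℝ (Fin n) → SpaceTime n) := by
  refine LipschitzWith.of_dist_le_mul fun x x' => ?_
  rw [NNReal.coe_one, one_mul, dist_eq_norm, dist_eq_norm]
  refine (pow_le_pow_iff_left₀ (norm_nonneg _) (norm_nonneg _) two_ne_zero).1 ?_
  simp [norm_sq_eq_timePart_add_spacePart, timePart_sub, spacePart_sub]

@[fun_prop]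
lemma continuous_timePart : Continuous (timePart (d := n)) := by unfold timePart; fun_prop

@[fun_prop]
lemma continuous_spacePart : Continuous (spacePart (d := n)) := by unfold spacePart; fun_prop

lemma measurable_consTime :
    Measurable fun z : ℝ × EuclideanSpace ℝ (Fin n) => consTime z.1 z.2 := by
  refine Continuous.measurable ((PiLp.continuous_toLp 2 _).comp (continuous_pi fun i => ?_))
  refine Fin.cases ?_ (fun j => ?_) i
  · exact continuous_fst
  · simp only [Fin.cons_succ]
    fun_prop

lemma lintegral_spaceTime {f : SpaceTime n → ℝ≥0∞} (hf : Measurable f) :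
    ∫⁻ z, f z = ∫⁻ t : ℝ, ∫⁻ x, f (consTime t x) := by
  have hcons : Measurable fun z : ℝ × EuclideanSpace ℝ (Fin n) => f (consTime z.1 z.2) :=
    hf.comp measurable_consTime
  rw [← (PiLp.volume_preserving_toLp (Fin (n + 1))).lintegral_comp hf,
    ← (volume_preserving_piFinSuccAbove (fun _ : Fin (n + 1) => ℝ) 0).symm.lintegral_comp
      (f := fun y => f (WithLp.toLp 2 y)) (by fun_prop),
    Measure.volume_eq_prod, lintegral_prod _ (by fun_prop)]
  refine lintegral_congr fun t => ?_
  rw [← (PiLp.volume_preserving_toLp (Fin n)).lintegral_comp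
    (f := fun x => f (consTime t x)) (hcons.comp measurable_prodMk_left)]
  refine lintegral_congr fun y => congrArg f ?_
  simp [consTime, MeasurableEquiv.piFinSuccAbove, Fin.insertNthEquiv]

lemma exists_lintegral_comp_timePart_mul_decay_quadratic_le (hn : n ≤ 2) {p : ℝ} (hp : 1 < p)
    (K : ℝ≥0) :
    ∃ C : ℝ≥0, ∀ φ : SpaceTime n → ℝ, LipschitzWith K φ → ∀ (A : ℝ) (q : SpaceTime n)
      (w : ℝ → ℝ≥0∞), Measurable w →
        ∫⁻ y, w (timePart y) * decay p (A + ‖y - q‖ ^ 2 + φ y) ≤ (∫⁻ t, w t) * C := by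
  obtain ⟨C, hC⟩ := exists_lintegral_decay_quadratic_le (E := EuclideanSpace ℝ (Fin n))
    (by simpa using hn) volume hp K
  refine ⟨C, fun φ hφ A q w hw => ?_⟩
  have hφc := hφ.continuous
  rw [lintegral_spaceTime (by fun_prop), ← lintegral_mul_const _ hw]
  refine lintegral_mono fun t => ?_
  have hφt : LipschitzWith K (φ ∘ consTime t) := by
    simpa only [mul_one] using hφ.comp (lipschitzWith_consTime t)
  have hslice : ∀ x, A + ‖consTime t x - q‖ ^ 2 + φ (consTime t x) =
      A + (t - timePart q) ^ 2 + ‖x - spacePart q‖ ^ 2 + φ (consTime t x) := fun x => by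
    rw [norm_sq_eq_timePart_add_spacePart, timePart_sub, spacePart_sub, timePart_consTime,
      spacePart_consTime, ← add_assoc]
  have hdecay : Measurable fun x => decay p (A + ‖consTime t x - q‖ ^ 2 + φ (consTime t x)) := by
    have hcons := (lipschitzWith_consTime (n := n) t).continuous
    fun_prop
  simp only [timePart_consTime]
  rw [lintegral_const_mul _ hdecay]
  simp only [hslice]
  gcongr
  exact hC _ hφt _ _

lemma exists_lintegral_decay_quadratic_mul_decay_norm_le {d : ℕ} (hd : d ≤ 3) {p m : ℝ}
    (hp : 1 < p) (hm : 0 ≤ m) (hdm : (d : ℝ) - 2 < m) (K : ℝ≥0) :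
    ∃ C : ℝ≥0, ∀ φ : EuclideanSpace ℝ (Fin d) → ℝ, LipschitzWith K φ → ∀ A q,
      ∫⁻ y, decay p (A + ‖y - q‖ ^ 2 + φ y) * decay m ‖y‖ ≤ C := by
  rcases Nat.le_succ_iff.1 hd with hd | rfl
  · obtain ⟨C, hC⟩ := exists_lintegral_decay_quadratic_le (E := EuclideanSpace ℝ (Fin d))
      (by simpa using hd) volume hp K
    exact ⟨C, fun φ hφ A q => (lintegral_mono fun y =>
      mul_le_of_le_one_right' (decay_le_one hm _)).trans (hC φ hφ A q)⟩
  · have hm1 : 1 < m := by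
      norm_num at hdm
      exact hdm
    obtain ⟨C, hC⟩ := exists_lintegral_comp_timePart_mul_decay_quadratic_le le_rfl hp K
    refine ⟨(∫⁻ t, decay m t).toNNReal * C, fun φ hφ A q => ?_⟩
    rw [ENNReal.coe_mul, ENNReal.coe_toNNReal (lintegral_decay_lt_top hm1).ne]
    refine (lintegral_mono fun y => ?_).trans (hC φ hφ A q _ (measurable_decay m))
    rw [mul_comm]
    gcongr
    exact decay_le_decay_of_abs_le hm ((abs_timePart_le_norm y).trans (le_abs_self _))

lemma ofReal_mul_lintegral_comp_add_mul_le {N : ℝ} (hN : 0 < N) (A : ℝ) {f : ℝ → ℝ≥0∞}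
    (hf : Measurable f) : ENNReal.ofReal N * ∫⁻ t, f (A + N * t) ≤ ∫⁻ x, f x := by
  have h : AntilipschitzWith (Real.toNNReal N)⁻¹ fun t : ℝ => A + N * t := by
    refine AntilipschitzWith.of_le_mul_dist fun u v => ?_
    rw [NNReal.coe_inv, Real.coe_toNNReal _ hN.le, dist_add_left, Real.dist_eq, Real.dist_eq,
      ← mul_sub, abs_mul, abs_of_pos hN, inv_mul_cancel_left₀ hN.ne']
  calc _ ≤ ENNReal.ofReal N * (((Real.toNNReal N)⁻¹ : ℝ≥0) * ∫⁻ x, f x) := by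
        gcongr
        exact lintegral_comp_le_of_antilipschitz h (by fun_prop) hf
    _ = ∫⁻ x, f x := by
        rw [← mul_assoc, ENNReal.ofReal, ← ENNReal.coe_mul,
          mul_inv_cancel₀ (Real.toNNReal_pos.2 hN).ne', ENNReal.coe_one, one_mul]

lemma exists_isometry_inner_eq_norm_mul_timePart (η : SpaceTime n) :
    ∃ R : SpaceTime n ≃ₗᵢ[ℝ] SpaceTime n, ∀ y, inner ℝ (R y) η = ‖η‖ * timePart y := by
  set e : SpaceTime n := EuclideanSpace.single 0 ‖η‖
  have he : ‖e‖ = ‖η‖ := by simp [e]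
  refine ⟨(ℝ ∙ (e - η))ᗮ.reflection, fun y => ?_⟩
  calc inner ℝ ((ℝ ∙ (e - η))ᗮ.reflection y) η
      = inner ℝ ((ℝ ∙ (e - η))ᗮ.reflection y) ((ℝ ∙ (e - η))ᗮ.reflection e) := by
        rw [Submodule.reflection_sub he]
    _ = ‖η‖ * timePart y := by
        rw [LinearIsometryEquiv.inner_map_map, EuclideanSpace.inner_single_right]
        simp [timePart]

lemma exists_ofReal_norm_mul_lintegral_decay_inner_mul_decay_quadratic_le {d : ℕ} (hd : d ≤ 3)
    {p : ℝ} (hp : 1 < p) (K : ℝ≥0) :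
    ∃ C : ℝ≥0, ∀ φ : EuclideanSpace ℝ (Fin d) → ℝ, LipschitzWith K φ → ∀ A B η,
      ENNReal.ofReal ‖η‖ * ∫⁻ y, decay p (A + inner ℝ y η) * decay p (B + ‖y‖ ^ 2 + φ y) ≤ C := by
  rcases d with _ | n
  · exact ⟨0, fun φ _ A B η => by simp [Subsingleton.elim η 0]⟩
  obtain ⟨C, hC⟩ := exists_lintegral_comp_timePart_mul_decay_quadratic_le (n := n) (by omega) hp K
  refine ⟨(∫⁻ t, decay p t).toNNReal * C, fun φ hφ A B η => ?_⟩
  rw [ENNReal.coe_mul, ENNReal.coe_toNNReal (lintegral_decay_lt_top hp).ne]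
  rcases eq_or_ne η 0 with rfl | hη
  · simp
  have hφc := hφ.continuous
  obtain ⟨R, hR⟩ := exists_isometry_inner_eq_norm_mul_timePart η
  have hφR : LipschitzWith K (φ ∘ R) := by simpa only [mul_one] using hφ.comp R.lipschitz
  calc _ = ENNReal.ofReal ‖η‖ * ∫⁻ y : SpaceTime n, decay p (A + ‖η‖ * timePart y) *
          decay p (B + ‖y - 0‖ ^ 2 + φ (R y)) := by
        rw [← R.measurePreserving.lintegral_comp (by fun_prop)]
        simp only [hR, LinearIsometryEquiv.norm_map, sub_zero]
    _ ≤ ENNReal.ofReal ‖η‖ * ((∫⁻ t, decay p (A + ‖η‖ * t)) * C) := by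
        gcongr
        exact hC _ hφR B 0 _ (by fun_prop)
    _ ≤ _ := by
        rw [← mul_assoc]
        gcongr
        exact ofReal_mul_lintegral_comp_add_mul_le (norm_pos_iff.2 hη) A (measurable_decay p)

end Slicing

section SquareNorm

variable {α : Type*} [MeasurableSpace α] {μ : Measure α}

lemma eLpNorm_two_sq {ε : Type*} [TopologicalSpace ε] [ContinuousENorm ε] (f : α → ε) :
    eLpNorm f 2 μ ^ 2 = ∫⁻ x, ‖f x‖ₑ ^ 2 ∂μ := by
  simpa only [NNReal.coe_ofNat, ENNReal.coe_ofNat, ENNReal.rpow_two] using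
    eLpNorm_nnreal_pow_eq_lintegral (f := f) (μ := μ) (p := 2) two_ne_zero

lemma sq_lintegral_mul_le {f g : α → ℝ≥0∞} (hf : AEMeasurable f μ) (hg : AEMeasurable g μ) :
    (∫⁻ x, f x * g x ∂μ) ^ 2 ≤ (∫⁻ x, f x ^ 2 ∂μ) * ∫⁻ x, g x ^ 2 ∂μ := by
  have h := ENNReal.lintegral_mul_le_Lp_mul_Lq μ Real.HolderConjugate.two_two hf hg
  simp only [Pi.mul_apply, ENNReal.rpow_two] at h
  refine (pow_le_pow_left' h 2).trans_eq ?_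
  rw [mul_pow, ← ENNReal.rpow_natCast, ← ENNReal.rpow_natCast, ← ENNReal.rpow_mul,
    ← ENNReal.rpow_mul]
  norm_num

lemma eLpNorm_two_le_of_forall_lintegral_mul_le [SigmaFinite μ] {H : α → ℝ≥0∞} {K : ℝ≥0∞}
    (h : ∀ Φ : α → ℝ≥0∞, Measurable Φ → ∫⁻ x, H x * Φ x ∂μ ≤ K * eLpNorm Φ 2 μ) :
    eLpNorm H 2 μ ≤ K := by
  by_contra! hK
  have hK2 : K ^ 2 < ∫⁻ x, H x ^ 2 ∂μ := by
    simpa only [eLpNorm_two_sq, enorm_eq_self] using ENNReal.pow_lt_pow_left two_ne_zero hK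
  simp_rw [lintegral_eq_nnreal, lt_iSup_iff] at hK2
  obtain ⟨φ, hφH, hφ⟩ := hK2
  rw [← SimpleFunc.lintegral_eq_lintegral, SimpleFunc.coe_map] at hφ
  obtain ⟨g, hgφ, hg_top, hg⟩ := SimpleFunc.exists_lt_lintegral_simpleFunc_of_lt_lintegral hφ
  set Φ : α → ℝ≥0∞ := fun x => (g x : ℝ≥0∞) ^ (1 / 2 : ℝ)
  have hΦ : Measurable Φ := g.measurable.coe_nnreal_ennreal.pow_const _
  have hΦ_sq : ∀ x, Φ x ^ 2 = g x := fun x => by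
    rw [← ENNReal.rpow_two, ← ENNReal.rpow_mul]
    norm_num
  have hΦ_norm : eLpNorm Φ 2 μ ^ 2 = ∫⁻ x, g x ∂μ := by
    simp only [eLpNorm_two_sq, enorm_eq_self, hΦ_sq]
  have hΦH : ∀ x, Φ x ≤ H x := fun x => (ENNReal.pow_le_pow_left_iff two_ne_zero).1 <|
    (hΦ_sq x).trans_le ((ENNReal.coe_le_coe.2 (hgφ x)).trans (hφH x))
  have hle : eLpNorm Φ 2 μ * eLpNorm Φ 2 μ ≤ K * eLpNorm Φ 2 μ := calc
    _ = ∫⁻ x, Φ x * Φ x ∂μ := by simp only [← sq, eLpNorm_two_sq, enorm_eq_self]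
    _ ≤ ∫⁻ x, H x * Φ x ∂μ := lintegral_mono fun x => mul_le_mul_left (hΦH x) _
    _ ≤ _ := h Φ hΦ
  have hΦ0 : eLpNorm Φ 2 μ ≠ 0 := fun h0 => by simp [← hΦ_norm, h0] at hg
  have hΦ_top : eLpNorm Φ 2 μ ≠ ⊤ := fun ht => by simp [← hΦ_norm, ht] at hg_top
  rw [← hΦ_norm] at hg
  exact hg.not_ge (pow_le_pow_left' ((ENNReal.mul_le_mul_iff_left hΦ0 hΦ_top).1 hle) 2)

end SquareNorm

section Trilinear

variable {E : Type*} [AddCommGroup E] [MeasureSpace E]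

lemma lintegral_prod_eq_lintegral_add_sub [MeasurableAdd₂ E] [MeasurableNeg E]
    [SFinite (volume : Measure E)] [(volume : Measure E).IsAddLeftInvariant] {H : E × E → ℝ≥0∞}
    (hH : Measurable H) : ∫⁻ q, H q = ∫⁻ w, ∫⁻ y, H (y, w - y) := by
  rw [Measure.volume_eq_prod,
    ← (measurePreserving_prod_sub_swap (volume : Measure E) volume).lintegral_comp hH,
    lintegral_prod _ (by fun_prop)]

/-- The weighted trilinear form `∫∫ (A F)(x) (B W)(y) (D G)(x + y) dx dy` on nonnegative functions
is bounded by `C` times the product of the `L²` norms of `F`, `W` and `G`.  In this form the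
convolution estimate for the weights `A`, `B` and `1 / D` is symmetric in its three functions. -/
def TrilinearBound (A B D : E → ℝ≥0∞) (C : ℝ≥0) : Prop :=
  ∀ F W G : E → ℝ≥0∞, Measurable F → Measurable W → Measurable G →
    ∫⁻ q : E × E, A q.1 * F q.1 * (B q.2 * W q.2) * (D (q.1 + q.2) * G (q.1 + q.2)) ≤
      C * eLpNorm F 2 * eLpNorm W 2 * eLpNorm G 2

namespace TrilinearBound

variable {A B D A' B' D' : E → ℝ≥0∞} {C C' : ℝ≥0}

lemma swap [SigmaFinite (volume : Measure E)] (h : TrilinearBound A B D C) :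
    TrilinearBound B A D C := by
  intro F W G hF hW hG
  rw [mul_right_comm (C : ℝ≥0∞)]
  refine (le_of_eq ?_).trans (h W F G hW hF hG)
  rw [Measure.volume_eq_prod, ← lintegral_prod_swap]
  refine lintegral_congr fun q => ?_
  rw [Prod.fst_swap, Prod.snd_swap, add_comm q.2, mul_comm (B q.2 * F q.2)]

lemma of_sq_le {S : ℝ≥0} (h : ∀ F W G : E → ℝ≥0∞, Measurable F → Measurable W → Measurable G →
    (∫⁻ q : E × E, A q.1 * F q.1 * (B q.2 * W q.2) * (D (q.1 + q.2) * G (q.1 + q.2))) ^ 2 ≤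
      S * ((∫⁻ x, F x ^ 2) * (∫⁻ x, W x ^ 2) * ∫⁻ x, G x ^ 2)) :
    TrilinearBound A B D (NNReal.sqrt S) := by
  intro F W G hF hW hG
  refine (ENNReal.pow_le_pow_left_iff two_ne_zero).1 ((h F W G hF hW hG).trans_eq ?_)
  rw [mul_pow, mul_pow, mul_pow, ← ENNReal.coe_pow, NNReal.sq_sqrt]
  simp only [eLpNorm_two_sq, enorm_eq_self]
  ring

lemma mono (h : TrilinearBound A B D C) (hA : ∀ x, A' x ≤ A x) (hB : ∀ x, B' x ≤ B x)
    (hD : ∀ x, D' x ≤ D x) : TrilinearBound A' B' D' C := fun F W G hF hW hG =>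
  (lintegral_mono fun q => by
    dsimp only
    gcongr <;> apply_assumption).trans (h F W G hF hW hG)

variable [MeasurableAdd₂ E]

lemma of_le_mul_add (h : TrilinearBound A B D C) (h' : TrilinearBound A B' D C')
    (hA : Measurable A) (hB : Measurable B) (hD : Measurable D) {c : ℝ≥0} {b : E → ℝ≥0∞}
    (hb : ∀ x, b x ≤ c * (B x + B' x)) : TrilinearBound A b D (c * (C + C')) := by
  intro F W G hF hW hG
  calc _ ≤ ∫⁻ q : E × E, c *
        (A q.1 * F q.1 * (B q.2 * W q.2) * (D (q.1 + q.2) * G (q.1 + q.2)) +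
          A q.1 * F q.1 * (B' q.2 * W q.2) * (D (q.1 + q.2) * G (q.1 + q.2))) := by
        refine lintegral_mono fun q => ?_
        refine (mul_le_mul_left (mul_le_mul_right (mul_le_mul_left (hb q.2) _) _) _).trans_eq ?_
        ring
    _ = c * ((∫⁻ q : E × E, A q.1 * F q.1 * (B q.2 * W q.2) * (D (q.1 + q.2) * G (q.1 + q.2))) +
          ∫⁻ q : E × E, A q.1 * F q.1 * (B' q.2 * W q.2) * (D (q.1 + q.2) * G (q.1 + q.2))) := by
        rw [lintegral_const_mul' _ _ ENNReal.coe_ne_top, lintegral_add_left (by fun_prop)]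
    _ ≤ c * (C * eLpNorm F 2 * eLpNorm W 2 * eLpNorm G 2 +
          C' * eLpNorm F 2 * eLpNorm W 2 * eLpNorm G 2) := by
        gcongr
        exacts [h F W G hF hW hG, h' F W G hF hW hG]
    _ = _ := by
        push_cast
        ring

lemma interpolate (h : TrilinearBound A B D C) (h' : TrilinearBound A' B' D' C')
    (hA : Measurable A) (hB : Measurable B) (hD : Measurable D) (hA' : Measurable A')
    (hB' : Measurable B') (hD' : Measurable D') {θ : ℝ} (hθ0 : 0 ≤ θ) (hθ1 : θ ≤ 1) :
    TrilinearBound (fun x => A x ^ θ * A' x ^ (1 - θ)) (fun x => B x ^ θ * B' x ^ (1 - θ))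
      (fun x => D x ^ θ * D' x ^ (1 - θ)) (C ^ θ * C' ^ (1 - θ)) := by
  intro F W G hF hW hG
  have hθ : 0 ≤ 1 - θ := sub_nonneg.2 hθ1
  have hsplit : ∀ x : ℝ≥0∞, x ^ θ * x ^ (1 - θ) = x := fun x => by
    rw [← ENNReal.rpow_add_of_nonneg _ _ hθ0 hθ, add_sub_cancel, ENNReal.rpow_one]
  calc _ = ∫⁻ q : E × E,
        (A q.1 * F q.1 * (B q.2 * W q.2) * (D (q.1 + q.2) * G (q.1 + q.2))) ^ θ *
        (A' q.1 * F q.1 * (B' q.2 * W q.2) * (D' (q.1 + q.2) * G (q.1 + q.2))) ^ (1 - θ) := by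
        refine lintegral_congr fun q => ?_
        conv_lhs => rw [← hsplit (F q.1), ← hsplit (W q.2), ← hsplit (G (q.1 + q.2))]
        simp only [ENNReal.mul_rpow_of_nonneg _ _ hθ0, ENNReal.mul_rpow_of_nonneg _ _ hθ]
        ring
    _ ≤ (C * (eLpNorm F 2 * eLpNorm W 2 * eLpNorm G 2)) ^ θ *
        (C' * (eLpNorm F 2 * eLpNorm W 2 * eLpNorm G 2)) ^ (1 - θ) := by
        refine (ENNReal.lintegral_mul_norm_pow_le (by fun_prop) (by fun_prop) hθ0 hθ
          (add_sub_cancel _ _)).trans ?_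
        gcongr
        · simpa only [mul_assoc] using h F W G hF hW hG
        · simpa only [mul_assoc] using h' F W G hF hW hG
    _ = C ^ θ * C' ^ (1 - θ) * (eLpNorm F 2 * eLpNorm W 2 * eLpNorm G 2) := by
        rw [ENNReal.mul_rpow_of_nonneg _ _ hθ0, ENNReal.mul_rpow_of_nonneg _ _ hθ,
          mul_mul_mul_comm, hsplit]
    _ = _ := by
        rw [ENNReal.coe_mul, ENNReal.coe_rpow_of_nonneg _ hθ0, ENNReal.coe_rpow_of_nonneg _ hθ]
        ring

variable [SigmaFinite (volume : Measure E)] [MeasurableNeg E]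
  [(volume : Measure E).IsAddLeftInvariant]

lemma rotate [(volume : Measure E).IsNegInvariant] (h : TrilinearBound A B D C)
    (hA : Measurable A) (hB : Measurable B) (hD : Measurable D) :
    TrilinearBound D (fun x => A (-x)) B C := by
  intro F W G hF hW hG
  have hW' : eLpNorm (fun x => W (-x)) 2 = eLpNorm W 2 :=
    eLpNorm_comp_measurePreserving hW.aestronglyMeasurable (Measure.measurePreserving_neg volume)
  rw [mul_right_comm (C : ℝ≥0∞), mul_right_comm, ← hW']
  refine (le_of_eq ?_).trans (h _ G F (hW.comp measurable_neg) hG hF)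
  rw [Measure.volume_eq_prod,
    ← (measurePreserving_add_prod_neg (volume : Measure E) volume).lintegral_comp (by fun_prop)]
  refine lintegral_congr fun q => ?_
  dsimp only
  rw [neg_neg, add_neg_cancel_right, add_comm q.2]
  ring

lemma of_fiber (hA : Measurable A) (hB : Measurable B) (hD : Measurable D) {S : ℝ≥0}
    (hS : ∀ w, D w ^ 2 * ∫⁻ y, A y ^ 2 * B (w - y) ^ 2 ≤ S) :
    TrilinearBound A B D (NNReal.sqrt S) := by
  refine of_sq_le fun F W G hF hW hG => ?_
  have hFW : ∫⁻ q : E × E, (F q.1 * W q.2) ^ 2 = (∫⁻ x, F x ^ 2) * ∫⁻ x, W x ^ 2 := by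
    simp only [mul_pow]
    exact lintegral_prod_mul (hF.pow_const 2).aemeasurable (hW.pow_const 2).aemeasurable
  have hG : ∫⁻ q : E × E, (A q.1 * B q.2 * (D (q.1 + q.2) * G (q.1 + q.2))) ^ 2 ≤
      S * ∫⁻ x, G x ^ 2 := by
    rw [lintegral_prod_eq_lintegral_add_sub (by fun_prop), ← lintegral_const_mul _ (by fun_prop)]
    refine lintegral_mono fun w => ?_
    calc ∫⁻ y, (A y * B (w - y) * (D (y + (w - y)) * G (y + (w - y)))) ^ 2
        = G w ^ 2 * (D w ^ 2 * ∫⁻ y, A y ^ 2 * B (w - y) ^ 2) := by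
          rw [← mul_assoc, ← lintegral_const_mul _ (by fun_prop)]
          refine lintegral_congr fun y => ?_
          rw [add_sub_cancel]
          ring
      _ ≤ G w ^ 2 * S := by gcongr; exact hS w
      _ = S * G w ^ 2 := mul_comm _ _
  calc _ = (∫⁻ q : E × E, F q.1 * W q.2 * (A q.1 * B q.2 * (D (q.1 + q.2) * G (q.1 + q.2)))) ^ 2 :=
        congrArg (· ^ 2) (lintegral_congr fun q => by ring)
    _ ≤ (∫⁻ x, F x ^ 2) * (∫⁻ x, W x ^ 2) * (S * ∫⁻ x, G x ^ 2) := by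
        refine (sq_lintegral_mul_le (by fun_prop) (by fun_prop)).trans ?_
        rw [hFW]
        gcongr
    _ = _ := by ring

/-- Cauchy-Schwarz in `x` for fixed `y`, and then in `y`, leaves `B` and `D` at points that are no
longer tied to each other: the argument of `B` comes from the variable of `G`. -/
lemma of_crossed {ρ : E → ℝ≥0∞} (hA : Measurable A) (hB : Measurable B) (hD : Measurable D)
    (hρ : Measurable ρ) {S : ℝ≥0}
    (hS : ∀ x w, ρ x ^ 2 * ∫⁻ y, A y ^ 2 * (D (y + x) ^ 2 * B (w - y) ^ 2) ≤ S) :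
    TrilinearBound A (fun x => ρ x * B x) D (NNReal.sqrt S) := by
  refine of_sq_le fun F W G hF hW hG => ?_
  set P : E → ℝ≥0∞ := fun y => ∫⁻ x, ρ x * W x * D (y + x) * (B x * G (y + x))
  have hP : Measurable P := Measurable.lintegral_prod_right'
    (f := fun q : E × E => ρ q.2 * W q.2 * D (q.1 + q.2) * (B q.2 * G (q.1 + q.2))) (by fun_prop)
  have hP_sq : ∀ y, P y ^ 2 ≤
      ∫⁻ p : E × E, (ρ p.1 * W p.1 * D (y + p.1)) ^ 2 * (B (p.2 - y) * G p.2) ^ 2 := fun y => by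
    refine (sq_lintegral_mul_le (by fun_prop) (by fun_prop)).trans_eq ?_
    rw [← lintegral_sub_right_eq_self (fun x => (B x * G (y + x)) ^ 2) y]
    simp only [add_sub_cancel]
    exact (lintegral_prod_mul (f := fun x => (ρ x * W x * D (y + x)) ^ 2)
      (g := fun w => (B (w - y) * G w) ^ 2) (by fun_prop) (by fun_prop)).symm
  have hAP : ∫⁻ y, (A y * P y) ^ 2 ≤ S * ((∫⁻ x, W x ^ 2) * ∫⁻ x, G x ^ 2) := calc
    _ ≤ ∫⁻ y, ∫⁻ p : E × E, A y ^ 2 *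
          ((ρ p.1 * W p.1 * D (y + p.1)) ^ 2 * (B (p.2 - y) * G p.2) ^ 2) := by
        refine lintegral_mono fun y => ?_
        rw [mul_pow, lintegral_const_mul _ (by fun_prop)]
        gcongr
        exact hP_sq y
    _ = ∫⁻ p : E × E, W p.1 ^ 2 * G p.2 ^ 2 *
          (ρ p.1 ^ 2 * ∫⁻ y, A y ^ 2 * (D (y + p.1) ^ 2 * B (p.2 - y) ^ 2)) := by
        rw [lintegral_lintegral_swap (by fun_prop)]
        refine lintegral_congr fun p => ?_
        rw [← mul_assoc, ← lintegral_const_mul _ (by fun_prop)]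
        exact lintegral_congr fun y => by ring
    _ ≤ ∫⁻ p : E × E, W p.1 ^ 2 * G p.2 ^ 2 * S := by
        gcongr with p
        exact hS p.1 p.2
    _ = _ := by
        rw [lintegral_mul_const _ (by fun_prop), mul_comm, Measure.volume_eq_prod]
        exact congrArg _ (lintegral_prod_mul (hW.pow_const 2).aemeasurable
          (hG.pow_const 2).aemeasurable)
  calc _ = (∫⁻ y, F y * (A y * P y)) ^ 2 := by
        rw [Measure.volume_eq_prod, lintegral_prod _ (by fun_prop)]
        congr 1
        refine lintegral_congr fun y => ?_
        rw [← mul_assoc, ← lintegral_const_mul _ (by fun_prop)]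
        exact lintegral_congr fun x => by ring
    _ ≤ (∫⁻ x, F x ^ 2) * (S * ((∫⁻ x, W x ^ 2) * ∫⁻ x, G x ^ 2)) := by
        refine (sq_lintegral_mul_le (g := fun y => A y * P y) hF.aemeasurable
          (hA.mul hP).aemeasurable).trans ?_
        gcongr
    _ = _ := by ring

lemma eLpNorm_convolution_le (h : TrilinearBound A B D C) (hA : Measurable A) (hB : Measurable B)
    (hD : Measurable D) {F W : E → ℝ≥0∞} (hF : Measurable F) (hW : Measurable W) :
    eLpNorm (fun w => D w * ∫⁻ y, A y * F y * (B (w - y) * W (w - y))) 2 ≤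
      C * eLpNorm F 2 * eLpNorm W 2 := by
  refine eLpNorm_two_le_of_forall_lintegral_mul_le fun Φ hΦ => ?_
  refine (le_of_eq ?_).trans (h F W Φ hF hW hΦ)
  rw [lintegral_prod_eq_lintegral_add_sub (by fun_prop)]
  refine lintegral_congr fun w => ?_
  rw [mul_right_comm, ← lintegral_const_mul _ (by fun_prop)]
  refine lintegral_congr fun y => ?_
  rw [add_sub_cancel, mul_comm]

end TrilinearBound

end Trilinear

section ModulationWeights

variable {d : ℕ} {h : EuclideanSpace ℝ (Fin d) → ℝ}

/-- The distance `τ - h(ξ)` of the frequency `(τ, ξ)` to the graph of the phase `h`. -/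
def modulation (h : EuclideanSpace ℝ (Fin d) → ℝ) (ζ : SpaceTime d) : ℝ :=
  timePart ζ - h (spacePart ζ)

/-- The reciprocal `⟨ξ⟩^(-s) ⟨τ - h(ξ)⟩^(-b)` of the Bourgain weight. -/
def modulationDecay (h : EuclideanSpace ℝ (Fin d) → ℝ) (s b : ℝ) (ζ : SpaceTime d) : ℝ≥0∞ :=
  decay s ‖spacePart ζ‖ * decay b (modulation h ζ)

@[fun_prop]
lemma measurable_modulationDecay (hh : Measurable h) (s b : ℝ) :
    Measurable (modulationDecay h s b) := by
  unfold modulationDecay modulation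
  fun_prop

lemma modulationDecay_zero_right (s : ℝ) (ζ : SpaceTime d) :
    modulationDecay h s 0 ζ = decay s ‖spacePart ζ‖ := by
  rw [modulationDecay, decay_zero, mul_one]

lemma modulationDecay_zero_left (b : ℝ) (ζ : SpaceTime d) :
    modulationDecay h 0 b ζ = decay b (modulation h ζ) := by
  rw [modulationDecay, decay_zero, one_mul]

lemma modulationDecay_sq (s b : ℝ) (ζ : SpaceTime d) :
    modulationDecay h s b ζ ^ 2 = modulationDecay h (2 * s) (2 * b) ζ := by
  simp only [modulationDecay, mul_pow, decay_sq]

lemma modulationDecay_le_of_le {s b s' b' : ℝ} (hs : s ≤ s') (hb : b ≤ b') (ζ : SpaceTime d) :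
    modulationDecay h s' b' ζ ≤ modulationDecay h s b ζ :=
  mul_le_mul' (decay_le_decay_of_le hs _) (decay_le_decay_of_le hb _)

lemma modulationDecay_rpow_mul_rpow (s b s' b' : ℝ) {θ : ℝ} (hθ0 : 0 ≤ θ) (hθ1 : θ ≤ 1)
    (ζ : SpaceTime d) :
    modulationDecay h s b ζ ^ θ * modulationDecay h s' b' ζ ^ (1 - θ) =
      modulationDecay h (θ * s + (1 - θ) * s') (θ * b + (1 - θ) * b') ζ := by
  simp only [modulationDecay, ENNReal.mul_rpow_of_nonneg _ _ hθ0,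
    ENNReal.mul_rpow_of_nonneg _ _ (sub_nonneg.2 hθ1), decay_rpow, ← decay_mul_decay]
  ring

lemma exists_lintegral_decay_modulation_mul_le {p : ℝ} (hp : 1 < p) :
    ∃ C : ℝ≥0, ∀ h : EuclideanSpace ℝ (Fin d) → ℝ, Measurable h →
      ∀ H : ℝ × EuclideanSpace ℝ (Fin d) → ℝ≥0∞, Measurable H →
      ∀ S : ℝ≥0, (∀ c, ∫⁻ ξ, H (c, ξ) ≤ S) →
        ∫⁻ ζ, decay p (modulation h ζ) * H (modulation h ζ, spacePart ζ) ≤ (C * S : ℝ≥0) := by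
  refine ⟨(∫⁻ c, decay p c).toNNReal, fun h hh H hH S hS => ?_⟩
  rw [ENNReal.coe_mul, ENNReal.coe_toNNReal (lintegral_decay_lt_top hp).ne]
  have hshift : ∀ ξ, ∫⁻ t, decay p (t - h ξ) * H (t - h ξ, ξ) = ∫⁻ c, decay p c * H (c, ξ) :=
    fun ξ => lintegral_sub_right_eq_self (fun c => decay p c * H (c, ξ)) (h ξ)
  unfold modulation
  rw [lintegral_spaceTime (by fun_prop)]
  simp only [timePart_consTime, spacePart_consTime]
  rw [lintegral_lintegral_swap (by fun_prop)]
  simp only [hshift]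
  rw [lintegral_lintegral_swap (by fun_prop), ← lintegral_mul_const _ (by fun_prop)]
  refine lintegral_mono fun c => ?_
  rw [lintegral_const_mul _ (by fun_prop)]
  gcongr
  exact hS c

@[fun_prop]
lemma continuous_schrodinger : Continuous (schrodinger (d := d)) := by
  unfold schrodinger
  fun_prop

lemma modulation_schrodinger (ζ : SpaceTime d) :
    modulation schrodinger ζ = timePart ζ + ‖spacePart ζ‖ ^ 2 := by
  rw [modulation, schrodinger, sub_neg_eq_add]

end ModulationWeights

section SchrodingerTrilinear

variable {d : ℕ}

lemma exists_trilinearBound_phase_schrodinger_one (hd : d ≤ 3) {β m : ℝ} (hβ : 1 / 2 < β)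
    (hm : 0 ≤ m) (hdm : (d : ℝ) - 2 < 2 * m) (K : ℝ≥0) :
    ∃ C : ℝ≥0, ∀ h : EuclideanSpace ℝ (Fin d) → ℝ, LipschitzWith K h →
      TrilinearBound (modulationDecay h m β) (modulationDecay schrodinger 0 β)
        (modulationDecay schrodinger 0 0) C := by
  obtain ⟨S, hS⟩ := exists_lintegral_decay_quadratic_mul_decay_norm_le hd (p := 2 * β)
    (m := 2 * m) (by linarith) (by linarith) hdm K
  obtain ⟨J, hJ⟩ := exists_lintegral_decay_modulation_mul_le (d := d) (p := 2 * β) (by linarith)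
  refine ⟨NNReal.sqrt (J * S), fun h hh => ?_⟩
  have hhm := hh.continuous.measurable
  refine TrilinearBound.of_fiber (by fun_prop) (by fun_prop) (by fun_prop) fun w => ?_
  refine le_trans (le_of_eq ?_) (hJ h hhm
    (fun z => decay (2 * β) (timePart w - z.1 + ‖z.2 - spacePart w‖ ^ 2 + -h z.2) *
      decay (2 * m) ‖z.2‖) (by fun_prop) S
    fun c => hS (fun ξ => -h ξ) hh.neg (timePart w - c) (spacePart w))
  simp only [modulationDecay_zero_left, decay_zero, one_pow, one_mul, modulationDecay_sq, decay_sq]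
  refine lintegral_congr fun y => ?_
  have hmod : modulation schrodinger (w - y) =
      timePart w - modulation h y + ‖spacePart y - spacePart w‖ ^ 2 + -h (spacePart y) := by
    rw [modulation_schrodinger, modulation, timePart_sub, spacePart_sub,
      norm_sub_rev (spacePart w)]
    ring
  rw [← hmod, modulationDecay]
  ring

lemma exists_trilinearBound_norm_schrodinger_schrodinger (hd : d ≤ 3) {β m : ℝ} (hβ : 1 / 2 < β)
    (hm : 0 ≤ m) (hdm : (d : ℝ) - 2 < 2 * m) :
    ∃ C : ℝ≥0, TrilinearBound (fun ζ => decay m ‖spacePart ζ‖)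
      (modulationDecay (schrodinger (d := d)) 0 β) (modulationDecay schrodinger 0 β) C := by
  obtain ⟨S, hS⟩ := exists_lintegral_decay_quadratic_mul_decay_norm_le hd (p := 2 * β)
    (m := 2 * m) (by linarith) (by linarith) hdm 0
  obtain ⟨J, hJ⟩ := exists_lintegral_decay_modulation_mul_le (d := d) (p := 2 * β) (by linarith)
  refine ⟨NNReal.sqrt (J * S), ?_⟩
  suffices hcrossed : ∀ x w : SpaceTime d, (1 : ℝ≥0∞) ^ 2 * ∫⁻ y, decay m ‖spacePart y‖ ^ 2 *
      (modulationDecay schrodinger 0 β (y + x) ^ 2 * modulationDecay schrodinger 0 β (w - y) ^ 2) ≤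
        (J * S : ℝ≥0) by
    simpa only [one_mul] using TrilinearBound.of_crossed (by fun_prop) (by fun_prop) (by fun_prop)
      measurable_const hcrossed
  intro x w
  set q : EuclideanSpace ℝ (Fin d) := (2⁻¹ : ℝ) • (spacePart w - spacePart x)
  set a : ℝ → ℝ := fun c =>
    (timePart x + timePart w - c) / 2 + ‖spacePart x + spacePart w‖ ^ 2 / 4
  set k : EuclideanSpace ℝ (Fin d) → ℝ := fun ξ => schrodinger (ξ + spacePart x) - timePart x
  have hleft : ∀ y, modulation schrodinger (y + x) = modulation k y := fun y => by
    simp only [modulation, k, timePart_add, spacePart_add]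
    ring
  have hright : ∀ y, modulation schrodinger (w - y) =
      2 * (a (modulation k y) + ‖spacePart y - q‖ ^ 2) := fun y => by
    simp only [modulation, a, k, q, schrodinger, timePart_sub,
      spacePart_sub, norm_sub_sq_real, norm_add_sq_real, norm_smul, inner_smul_right,
      inner_sub_right, mul_pow, real_inner_comm]
    norm_num
    ring
  refine (le_trans ?_ (hJ k (by fun_prop)
    (fun z => decay (2 * β) (a z.1 + ‖z.2 - q‖ ^ 2) * decay (2 * m) ‖z.2‖) (by fun_prop) S
    fun c => by simpa only [add_zero] using hS (fun _ => 0) (LipschitzWith.const 0) (a c) q))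
  rw [one_pow, one_mul]
  refine lintegral_mono fun y => ?_
  simp only [modulationDecay_zero_left, decay_sq, hleft, hright]
  rw [mul_left_comm, mul_comm (decay (2 * m) _)]
  gcongr
  refine decay_le_decay_of_abs_le (by linarith) ?_
  rw [abs_mul, abs_two]
  linarith [abs_nonneg (a (modulation k y) + ‖spacePart y - q‖ ^ 2)]

lemma exists_trilinearBound_sqrt_norm (hd : d ≤ 3) {β : ℝ} (hβ : 1 / 2 < β) (K : ℝ≥0) :
    ∃ C : ℝ≥0, ∀ h : EuclideanSpace ℝ (Fin d) → ℝ, LipschitzWith K h →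
      TrilinearBound (modulationDecay schrodinger 0 β)
        (fun ζ => ENNReal.ofReal √‖spacePart ζ‖ * modulationDecay h 0 β ζ)
        (modulationDecay schrodinger 0 β) C := by
  obtain ⟨S, hS⟩ := exists_ofReal_norm_mul_lintegral_decay_inner_mul_decay_quadratic_le hd
    (p := 2 * β) (by linarith) K
  obtain ⟨J, hJ⟩ := exists_lintegral_decay_modulation_mul_le (d := d) (p := 2 * β) (by linarith)
  refine ⟨NNReal.sqrt (J * S), fun h hh => ?_⟩
  have hhm := hh.continuous.measurable
  refine TrilinearBound.of_crossed (by fun_prop) (by fun_prop) (by fun_prop) (by fun_prop)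
    fun x w => ?_
  set η : EuclideanSpace ℝ (Fin d) := (2 : ℝ) • spacePart x with hη
  have hh_shift : LipschitzWith K fun ξ => -h (spacePart w - ξ) :=
    LipschitzWith.of_dist_le_mul fun ξ ξ' => by
      simpa only [dist_neg_neg, dist_sub_left] using
        hh.dist_le_mul (spacePart w - ξ) (spacePart w - ξ')
  have hnorm : ENNReal.ofReal √‖spacePart x‖ ^ 2 ≤ ENNReal.ofReal ‖η‖ := by
    rw [← ENNReal.ofReal_pow (by positivity), Real.sq_sqrt (by positivity), hη, norm_smul,
      Real.norm_two]
    exact ENNReal.ofReal_le_ofReal (by linarith [norm_nonneg (spacePart x)])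
  refine (mul_le_mul_left hnorm _).trans (le_trans (le_of_eq ?_) (hJ schrodinger (by fun_prop)
    (fun z => ENNReal.ofReal ‖η‖ * (decay (2 * β) (timePart x + z.1 + ‖spacePart x‖ ^ 2 +
      inner ℝ z.2 η) * decay (2 * β) (timePart w - z.1 + ‖z.2‖ ^ 2 + -h (spacePart w - z.2))))
    (by fun_prop) S fun c => ?_))
  · have hleft : ∀ y, modulation schrodinger (y + x) = timePart x + modulation schrodinger y +
        ‖spacePart x‖ ^ 2 + inner ℝ (spacePart y) η := fun y => by
      rw [modulation_schrodinger, modulation_schrodinger, timePart_add, spacePart_add,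
        norm_add_sq_real, hη, inner_smul_right]
      ring
    have hright : ∀ y, modulation h (w - y) = timePart w - modulation schrodinger y +
        ‖spacePart y‖ ^ 2 + -h (spacePart w - spacePart y) := fun y => by
      rw [modulation_schrodinger, modulation, timePart_sub, spacePart_sub]
      ring
    rw [← lintegral_const_mul _ (by fun_prop)]
    refine lintegral_congr fun y => ?_
    simp only [modulationDecay_zero_left, decay_sq, hleft, hright]
    ring
  · rw [lintegral_const_mul' _ _ ENNReal.ofReal_ne_top]
    exact hS (fun ξ => -h (spacePart w - ξ)) hh_shift (timePart x + c + ‖spacePart x‖ ^ 2)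
      (timePart w - c) η

lemma decay_neg_half_le {r : ℝ} (hr : 0 ≤ r) :
    decay (-1 / 2) r ≤ (2 : ℝ≥0) * (ENNReal.ofReal √r + decay 1 r) := by
  have hpos := bracket_pos r
  have hone := one_le_bracket r
  have hsq : bracket r ^ 2 = 1 + r ^ 2 := Real.sq_sqrt (by positivity)
  have hsqrt : √(bracket r) ≤ 2 * (√r + (bracket r)⁻¹) := by
    rcases le_total 1 r with hr1 | hr1
    · calc √(bracket r) ≤ √(2 ^ 2 * r) := Real.sqrt_le_sqrt (by nlinarith)
        _ = 2 * √r := by rw [Real.sqrt_mul (by positivity), Real.sqrt_sq zero_le_two]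
        _ ≤ 2 * (√r + (bracket r)⁻¹) := by linarith [inv_pos.2 hpos]
    · calc √(bracket r) ≤ bracket r := Real.sqrt_le_self_iff.2 (Or.inr hone)
        _ ≤ 2 * (bracket r)⁻¹ := by rw [← div_eq_mul_inv, le_div_iff₀ hpos]; nlinarith
        _ ≤ 2 * (√r + (bracket r)⁻¹) := by linarith [Real.sqrt_nonneg r]
  rw [decay, decay, neg_div, neg_neg, ← Real.sqrt_eq_rpow, Real.rpow_neg_one,
    ← ENNReal.ofReal_add (Real.sqrt_nonneg r) (inv_pos.2 hpos).le]
  refine (ENNReal.ofReal_le_ofReal hsqrt).trans_eq ?_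
  rw [ENNReal.ofReal_mul zero_le_two, ENNReal.ofReal_ofNat, ENNReal.coe_ofNat]

/-- With `⟨ξ⟩^(1/2) ≲ |ξ|^(1/2) + ⟨ξ⟩^(-1)`, the bound with the gain `|ξ|^(1/2)` covers the
frequencies `|ξ| ≥ 1` of the second function. -/
lemma exists_trilinearBound_neg_half (hd : d ≤ 3) {β : ℝ} (hβ : 1 / 2 < β) (K : ℝ≥0) :
    ∃ C : ℝ≥0, ∀ h : EuclideanSpace ℝ (Fin d) → ℝ, LipschitzWith K h →
      TrilinearBound (modulationDecay schrodinger 0 β) (modulationDecay h (-1 / 2) β)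
        (modulationDecay schrodinger 0 β) C := by
  obtain ⟨C, hC⟩ := exists_trilinearBound_sqrt_norm hd hβ K
  obtain ⟨C', hC'⟩ := exists_trilinearBound_phase_schrodinger_one hd hβ zero_le_one
    (by linarith [(Nat.cast_le (α := ℝ)).2 hd, Nat.cast_ofNat (R := ℝ) (n := 3)]) K
  refine ⟨2 * (C + C'), fun h hh => ?_⟩
  have hhm := hh.continuous.measurable
  refine (hC h hh).of_le_mul_add ((hC' h hh).swap.mono (fun _ => le_rfl) (fun _ => le_rfl)
    (modulationDecay_le_of_le le_rfl (by linarith))) (by fun_prop) (by fun_prop) (by fun_prop)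
    fun ζ => ?_
  rw [modulationDecay_zero_left, modulationDecay, modulationDecay, ← add_mul, ← mul_assoc]
  gcongr
  exact decay_neg_half_le (norm_nonneg _)

lemma exists_interpolation_parameters (hd : d ≤ 3) {s b b' : ℝ} (hb : 1 / 2 < b) (hbb' : b ≤ b')
    (hb'd : b' < (6 + 2 * s - d) / 4) (hb'1 : b' < 1) (hb's : b' < s + 1) :
    ∃ β θ m : ℝ, 1 / 2 < β ∧ β ≤ b ∧ 0 ≤ θ ∧ θ ≤ 1 ∧ θ * β = 1 - b' ∧
      θ * (-1 / 2) + (1 - θ) * m = s ∧ 0 ≤ m ∧ (d : ℝ) - 2 < 2 * m := by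
  have hθ : Tendsto (fun β : ℝ => (1 - b') / β) (𝓝[>] (1 / 2)) (𝓝 (2 * (1 - b'))) := by
    have hdiv : ContinuousAt (fun β : ℝ => (1 - b') / β) (1 / 2) := by fun_prop (disch := norm_num)
    convert hdiv.tendsto.mono_left nhdsWithin_le_nhds using 2
    ring
  have hdim : (d : ℝ) - 2 - 2 * s < 2 * (1 - b') * (d - 1) := by
    interval_cases d <;> norm_num at hb'd ⊢ <;> linarith
  obtain ⟨β, hβ, hβb, hθ1, hθs, hθd⟩ := (eventually_mem_nhdsWithin.and <|
    (eventually_mem_set.2 (Ioc_mem_nhdsGT hb)).and <|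
    (hθ.eventually_lt_const (by linarith : _ < (1 : ℝ))).and <|
    (hθ.eventually_const_lt (by linarith : -2 * s < _)).and <|
    (hθ.mul_const _).eventually_const_lt hdim).exists
  have hβ0 : 0 < β := one_half_pos.trans hβ
  have hθ' : 0 < 1 - (1 - b') / β := sub_pos.2 hθ1
  refine ⟨β, (1 - b') / β, (s + (1 - b') / β / 2) / (1 - (1 - b') / β), hβ, hβb.2,
    div_nonneg (by linarith) hβ0.le, hθ1.le, div_mul_cancel₀ _ hβ0.ne', ?_,
    div_nonneg (by linarith) hθ'.le, ?_⟩
  · rw [mul_div_cancel₀ _ hθ'.ne']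
    ring
  · rw [← mul_div_assoc, lt_div_iff₀ hθ']
    linarith

variable {s b b' : ℝ}

theorem exists_trilinearBound_schrodinger_output (hd : d ≤ 3) (hb : 1 / 2 < b) (hbb' : b ≤ b')
    (hb'd : b' < (6 + 2 * s - d) / 4) (hb'1 : b' < 1) (hb's : b' < s + 1) (K : ℝ≥0) :
    ∃ C : ℝ≥0, ∀ h : EuclideanSpace ℝ (Fin d) → ℝ, LipschitzWith K h →
      TrilinearBound (modulationDecay schrodinger 0 b) (modulationDecay h s b)
        (modulationDecay schrodinger 0 (1 - b')) C := by
  obtain ⟨β, θ, m, hβ, hβb, hθ0, hθ1, hθβ, hθs, hm, hdm⟩ :=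
    exists_interpolation_parameters hd hb hbb' hb'd hb'1 hb's
  obtain ⟨C, hC⟩ := exists_trilinearBound_neg_half hd hβ K
  obtain ⟨C', hC'⟩ := exists_trilinearBound_phase_schrodinger_one hd hβ hm hdm K
  refine ⟨C ^ θ * C' ^ (1 - θ), fun h hh => ?_⟩
  have hhm := hh.continuous.measurable
  have hinterp := (hC h hh).interpolate (hC' h hh).swap (by fun_prop) (by fun_prop) (by fun_prop)
    (by fun_prop) (by fun_prop) (by fun_prop) hθ0 hθ1
  simp only [modulationDecay_rpow_mul_rpow _ _ _ _ hθ0 hθ1] at hinterp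
  refine hinterp.mono ?_ ?_ ?_ <;> refine modulationDecay_le_of_le ?_ ?_ <;> linarith

theorem exists_trilinearBound_phase_output (hd : d ≤ 3) (hb : 1 / 2 < b) (hbb' : b ≤ b')
    (hb'd : b' < (6 + 2 * s - d) / 4) (hb'1 : b' < 1) (hb's : b' < s + 1) (K : ℝ≥0) :
    ∃ C : ℝ≥0, ∀ h : EuclideanSpace ℝ (Fin d) → ℝ, LipschitzWith K h →
      TrilinearBound (modulationDecay schrodinger 0 b) (modulationDecay h s (1 - b'))
        (modulationDecay schrodinger 0 b) C := by
  obtain ⟨β, θ, m, hβ, hβb, hθ0, hθ1, hθβ, hθs, hm, hdm⟩ :=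
    exists_interpolation_parameters hd hb hbb' hb'd hb'1 hb's
  obtain ⟨C, hC⟩ := exists_trilinearBound_neg_half hd hβ K
  obtain ⟨C', hC'⟩ := exists_trilinearBound_norm_schrodinger_schrodinger hd hβ hm hdm
  refine ⟨C ^ θ * C' ^ (1 - θ), fun h hh => ?_⟩
  have hhm := hh.continuous.measurable
  simp only [← modulationDecay_zero_right (h := h)] at hC'
  have hinterp := (hC h hh).interpolate hC'.swap (by fun_prop) (by fun_prop) (by fun_prop)
    (by fun_prop) (by fun_prop) (by fun_prop) hθ0 hθ1
  simp only [modulationDecay_rpow_mul_rpow _ _ _ _ hθ0 hθ1] at hinterp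
  refine hinterp.mono ?_ ?_ ?_ <;> refine modulationDecay_le_of_le ?_ ?_ <;> linarith

end SchrodingerTrilinear

section FourierInversion

variable {V : Type*} [NormedAddCommGroup V] [InnerProductSpace ℝ V] [FiniteDimensional ℝ V]
  [MeasurableSpace V] [BorelSpace V] {F G : V → ℂ}

lemma integral_schwartz_fourierInv_mul_eq (φ : 𝓢(V, ℂ)) (hF : Integrable F) :
    ∫ ζ, 𝓕⁻ φ ζ * F ζ = ∫ z, φ z * 𝓕⁻ F z := by
  have h := VectorFourier.integral_fourierIntegral_smul_eq_flip (L := innerₗ V)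
    Real.continuous_fourierChar (by exact continuous_inner) (φ.integrable (μ := volume)) hF.comp_neg
  rw [flip_innerₗ] at h
  rw [← integral_neg_eq_self, Real.fourierInv_eq_fourier_comp_neg]
  refine Eq.trans (integral_congr_ae (Eventually.of_forall fun ζ => ?_)) h
  simp only [SchwartzMap.fourierInv_coe, Real.fourierInv_eq_fourier_neg, neg_neg, smul_eq_mul]
  rfl

lemma fourierInv_mul_convolution_eq (hF : Integrable F) (hG : Integrable G) (z : V) :
    𝓕⁻ (F ⋆[ContinuousLinearMap.mul ℂ ℂ] G) z = 𝓕⁻ F z * 𝓕⁻ G z := by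
  simp only [Real.fourierInv_eq_fourier_neg]
  exact Real.fourier_mul_convolution_eq hF hG (-z)

lemma conj_fourierInv (F : V → ℂ) (z : V) :
    conj (𝓕⁻ F z) = 𝓕⁻ (fun ζ => conj (F (-ζ))) z := by
  rw [Real.fourierInv_eq, Real.fourierInv_eq, ← integral_conj, ← integral_neg_eq_self]
  refine integral_congr_ae (Eventually.of_forall fun ζ => ?_)
  simp only [Circle.smul_def, smul_eq_mul, map_mul, inner_neg_left, AddChar.map_neg_eq_inv,
    Circle.coe_inv_eq_conj, Complex.conj_conj]

lemma enorm_mul_convolution_smul_le {r : ℝ} (hr0 : 0 < r) (hr1 : r ≤ 1) (hF : Measurable F)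
    (hG : Measurable G) (ζ : V) :
    ‖(F ⋆[ContinuousLinearMap.mul ℂ ℂ] G) (r • ζ)‖ₑ ≤
      ∫⁻ x, ‖F (r • x)‖ₑ * ‖G (r • (ζ - x))‖ₑ := by
  have hjac : (1 : ℝ≥0∞) ≤ ENNReal.ofReal |(r ^ finrank ℝ V)⁻¹| := by
    rw [abs_of_pos (by positivity), ENNReal.one_le_ofReal]
    exact one_le_inv_iff₀.2 ⟨by positivity, pow_le_one₀ hr0.le hr1⟩
  calc ‖(F ⋆[ContinuousLinearMap.mul ℂ ℂ] G) (r • ζ)‖ₑ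
      ≤ ∫⁻ t, ‖F t‖ₑ * ‖G (r • ζ - t)‖ₑ := by
        rw [convolution_def]
        refine (enorm_integral_le_lintegral_enorm _).trans_eq (lintegral_congr fun t => ?_)
        rw [ContinuousLinearMap.mul_apply', enorm_mul]
    _ ≤ ENNReal.ofReal |(r ^ finrank ℝ V)⁻¹| * ∫⁻ t, ‖F t‖ₑ * ‖G (r • ζ - t)‖ₑ :=
        le_mul_of_one_le_left' hjac
    _ = ∫⁻ x, ‖F (r • x)‖ₑ * ‖G (r • (ζ - x))‖ₑ := by
        rw [← smul_eq_mul, ← lintegral_smul_measure, ← Measure.map_addHaar_smul volume hr0.ne',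
          lintegral_map (by fun_prop) (by fun_prop)]
        simp only [smul_sub]

end FourierInversion

section Distributions

variable {d : ℕ} {F G : SpaceTime d → ℂ} {u : 𝓢'(SpaceTime d, ℂ)}

namespace IsFunction

lemma locallyIntegrable (h : IsFunction F u) : LocallyIntegrable F volume := by
  intro x
  let φ : ContDiffBump x := ⟨1, 2, one_pos, one_lt_two⟩
  have hc : HasCompactSupport (Complex.ofRealCLM ∘ φ) := φ.hasCompactSupport.comp_left rfl
  have hint := (h (hc.toSchwartzMap (Complex.ofRealCLM.contDiff.comp φ.contDiff))).1
  refine ⟨ball x 1, ball_mem_nhds x one_pos, ?_⟩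
  refine hint.integrableOn.congr_fun (fun z hz => ?_) measurableSet_ball
  have hone : φ z = 1 := φ.one_of_mem_closedBall (ball_subset_closedBall hz)
  simp [hone]

lemma ae_eq (hF : IsFunction F u) (hG : IsFunction G u) : F =ᵐ[volume] G := by
  refine ae_eq_of_integral_contDiff_smul_eq hF.locallyIntegrable hG.locallyIntegrable
    fun g hg hgc => ?_
  have hc : HasCompactSupport (Complex.ofRealCLM ∘ g) := hgc.comp_left rfl
  let φ := hc.toSchwartzMap (Complex.ofRealCLM.contDiff.comp hg)
  exact (hF φ).2.symm.trans (hG φ).2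

lemma congr (hF : IsFunction F u) (h : F =ᵐ[volume] G) : IsFunction G u := by
  intro φ
  have hφ : (fun z => φ z * F z) =ᵐ[volume] fun z => φ z * G z := by
    filter_upwards [h] with z hz
    rw [hz]
  exact ⟨(hF φ).1.congr hφ, (hF φ).2.trans (integral_congr_ae hφ)⟩

lemma fourierInv (h : IsFunction F (𝓕 u)) (hF : Integrable F) : IsFunction (𝓕⁻ F) u := by
  intro φ
  constructor
  · rw [← Real.Lp.fourierTransformInv_toLp (memLp_one_iff_integrable.2 hF)]
    exact φ.integrable.mul_bdd (BoundedContinuousFunction.continuous _).aestronglyMeasurable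
      (Eventually.of_forall (BoundedContinuousFunction.norm_coe_le_norm _))
  · rw [← integral_schwartz_fourierInv_mul_eq φ hF, ← (h _).2, TemperedDistribution.fourier_apply,
      FourierTransform.fourier_fourierInv_eq]

end IsFunction

lemma exists_isFunction_fourier (hF : Integrable F) :
    ∃ u : 𝓢'(SpaceTime d, ℂ), IsFunction F (𝓕 u) := by
  have hm : MemLp F 1 volume := memLp_one_iff_integrable.2 hF
  refine ⟨𝓕⁻ ((hm.toLp F : Lp ℂ 1 volume) : 𝓢'(SpaceTime d, ℂ)), fun φ => ⟨?_, ?_⟩⟩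
  · exact hF.bdd_mul φ.continuous.aestronglyMeasurable
      (Eventually.of_forall (φ.norm_le_seminorm ℂ))
  · rw [FourierTransform.fourier_fourierInv_eq, Lp.toTemperedDistribution_apply]
    refine integral_congr_ae ?_
    filter_upwards [hm.coeFn_toLp] with z hz
    rw [hz, smul_eq_mul]

end Distributions

section GevreyWeights

variable {d : ℕ} {h : EuclideanSpace ℝ (Fin d) → ℝ} {σ s b : ℝ} {G : SpaceTime d → ℂ}
  {u : 𝓢'(SpaceTime d, ℂ)}

/-- The exponential weight `e^{σ‖ξ‖₁}` at `(τ, ξ)`, with values in `ℝ≥0∞` for use in Lebesgue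
integrals. -/
def expWeight (σ : ℝ) (ζ : SpaceTime d) : ℝ≥0∞ :=
  ENNReal.ofReal (Real.exp (σ * ∑ i, |spacePart ζ i|))

@[fun_prop]
lemma measurable_expWeight (σ : ℝ) : Measurable (expWeight (d := d) σ) := by
  unfold expWeight spacePart
  fun_prop

lemma expWeight_mul_expWeight (σ σ' : ℝ) (ζ : SpaceTime d) :
    expWeight σ ζ * expWeight σ' ζ = expWeight (σ + σ') ζ := by
  rw [expWeight, expWeight, ← ENNReal.ofReal_mul (Real.exp_pos _).le, ← Real.exp_add, ← add_mul,
    expWeight]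

lemma expWeight_zero (ζ : SpaceTime d) : expWeight 0 ζ = 1 := by simp [expWeight]

lemma expWeight_neg_apply (σ : ℝ) (ζ : SpaceTime d) : expWeight σ (-ζ) = expWeight σ ζ := by
  have habs : ∀ i, |spacePart (-ζ) i| = |spacePart ζ i| := fun i => abs_neg _
  simp only [expWeight, habs]

lemma expWeight_add_le (hσ : 0 ≤ σ) (x y : SpaceTime d) :
    expWeight σ (x + y) ≤ expWeight σ x * expWeight σ y := by
  rw [expWeight, expWeight, expWeight, ← ENNReal.ofReal_mul (Real.exp_pos _).le, ← Real.exp_add,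
    ← mul_add, ← Finset.sum_add_distrib]
  gcongr with i
  exact abs_add_le _ _

lemma modulationDecay_mul_modulationDecay (s b s' b' : ℝ) (ζ : SpaceTime d) :
    modulationDecay h s b ζ * modulationDecay h s' b' ζ =
      modulationDecay h (s + s') (b + b') ζ := by
  simp only [modulationDecay, ← decay_mul_decay]
  ring

lemma modulationDecay_neg_comp_neg (h : EuclideanSpace ℝ (Fin d) → ℝ) (s b : ℝ)
    (ζ : SpaceTime d) :
    modulationDecay (fun ξ => -h (-ξ)) s b ζ = modulationDecay h s b (-ζ) := by
  have hspace : spacePart (-ζ) = -spacePart ζ := rfl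
  have hmod : modulation (fun ξ => -h (-ξ)) ζ = -modulation h (-ζ) := by
    have htime : timePart (-ζ) = -timePart ζ := rfl
    rw [modulation, modulation, hspace, htime]
    ring
  rw [modulationDecay, modulationDecay, hspace, norm_neg, hmod, decay_neg]

lemma ofReal_weight (h : EuclideanSpace ℝ (Fin d) → ℝ) (σ s b : ℝ) (ζ : SpaceTime d) :
    ENNReal.ofReal (weight h σ s b ζ) = expWeight σ ζ * modulationDecay h (-s) (-b) ζ := by
  have hs : 0 ≤ bracket ‖spacePart ζ‖ ^ s := (Real.rpow_pos_of_pos (bracket_pos _) _).le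
  rw [weight, mul_assoc, ENNReal.ofReal_mul (Real.exp_pos _).le, ENNReal.ofReal_mul hs, expWeight,
    modulationDecay, decay, decay, neg_neg, neg_neg, modulation]

/-- The function `e^{σ‖ξ‖₁} ⟨ξ⟩^s ⟨τ - h(ξ)⟩^b |û(τ, ξ)|` whose `L²` norm is the Gevrey-Bourgain
norm of `u`, in terms of `G = 𝓕 u`; the dilation of `G` is the one in the definition of `gbNorm`. -/
def gbDensity (h : EuclideanSpace ℝ (Fin d) → ℝ) (σ s b : ℝ) (G : SpaceTime d → ℂ)
    (ζ : SpaceTime d) : ℝ≥0∞ :=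
  expWeight σ ζ * modulationDecay h (-s) (-b) ζ * ‖G ((2 * Real.pi)⁻¹ • ζ)‖ₑ

@[fun_prop]
lemma measurable_gbDensity (hh : Measurable h) (hG : Measurable G) :
    Measurable (gbDensity h σ s b G) := by
  unfold gbDensity
  fun_prop

lemma expWeight_mul_enorm (h : EuclideanSpace ℝ (Fin d) → ℝ) (σ s b : ℝ) (G : SpaceTime d → ℂ)
    (ζ : SpaceTime d) :
    expWeight σ ζ * ‖G ((2 * Real.pi)⁻¹ • ζ)‖ₑ =
      modulationDecay h s b ζ * gbDensity h σ s b G ζ := by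
  have hinv : modulationDecay h s b ζ * modulationDecay h (-s) (-b) ζ = 1 := by
    rw [modulationDecay_mul_modulationDecay, add_neg_cancel, add_neg_cancel,
      modulationDecay_zero_left, decay_zero]
  rw [gbDensity, ← mul_assoc, mul_left_comm, hinv, mul_one]

lemma gbDensity_neg_comp_neg (h : EuclideanSpace ℝ (Fin d) → ℝ) (σ s b : ℝ) (G : SpaceTime d → ℂ) :
    gbDensity (fun ξ => -h (-ξ)) σ s b (fun ζ => conj (G (-ζ))) =
      gbDensity h σ s b G ∘ Neg.neg := by
  ext ζ
  rw [Function.comp_apply, gbDensity, gbDensity, expWeight_neg_apply,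
    modulationDecay_neg_comp_neg, smul_neg, RCLike.enorm_conj]

lemma gbNorm_eq_eLpNorm_gbDensity (hG : IsFunction G (𝓕 u)) :
    gbNorm h σ s b u = eLpNorm (gbDensity h σ s b G) 2 := by
  have hdensity : ∀ G' : SpaceTime d → ℂ,
      eLpNorm (fun ζ => (weight h σ s b ζ : ℂ) * G' ((2 * Real.pi)⁻¹ • ζ)) 2 =
        eLpNorm (gbDensity h σ s b G') 2 := fun G' => by
    refine eLpNorm_congr_enorm_ae (Eventually.of_forall fun ζ => ?_)
    have hw : 0 ≤ weight h σ s b ζ := by unfold weight bracket; positivity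
    rw [enorm_mul, enorm_eq_self, gbDensity, ← ofReal_weight, ← ofReal_norm, Complex.norm_real,
      Real.norm_of_nonneg hw]
  simp only [gbNorm, hdensity]
  refine le_antisymm (iInf₂_le G hG) (le_iInf₂ fun G' hG' => (eLpNorm_congr_ae ?_).le)
  have hr : (2 * Real.pi)⁻¹ ≠ 0 := by positivity
  filter_upwards [(Measure.quasiMeasurePreserving_smul volume hr).ae_eq_comp (hG.ae_eq hG')]
    with ζ hζ
  rw [gbDensity, gbDensity, show G _ = G' _ from hζ]

end GevreyWeights

section FourierIntegrability

variable {d : ℕ} {h : EuclideanSpace ℝ (Fin d) → ℝ} {σ s b : ℝ}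

lemma exists_ofReal_exp_neg_le_decay (hσ : 0 < σ) (p : ℝ) :
    ∃ C : ℝ≥0, ∀ r : ℝ, 0 ≤ r → ENNReal.ofReal (Real.exp (-(σ * r))) ≤ C * decay p r := by
  set q := |p| + 1
  have hq : 0 < q := by positivity
  set δ := σ / q
  have hδ : 0 < δ := by positivity
  refine ⟨Real.toNNReal ((1 + δ⁻¹) ^ q), fun r hr => ?_⟩
  have hbracket : bracket r ≤ (1 + δ⁻¹) * Real.exp (δ * r) := by
    have hsqrt : bracket r ≤ 1 + r := by
      rw [bracket, Real.sqrt_le_left (by linarith)]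
      nlinarith
    have hδr : δ⁻¹ * (δ * r) = r := by field_simp
    nlinarith [Real.add_one_le_exp (δ * r), inv_pos.2 hδ, mul_nonneg hδ.le hr]
  have hpow : bracket r ^ p ≤ (1 + δ⁻¹) ^ q * Real.exp (σ * r) := by
    calc bracket r ^ p ≤ bracket r ^ q :=
          Real.rpow_le_rpow_of_exponent_le (one_le_bracket r) (by linarith [le_abs_self p])
      _ ≤ ((1 + δ⁻¹) * Real.exp (δ * r)) ^ q :=
          Real.rpow_le_rpow (bracket_pos r).le hbracket hq.le
      _ = (1 + δ⁻¹) ^ q * Real.exp (σ * r) := by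
          rw [Real.mul_rpow (by positivity) (Real.exp_pos _).le, ← Real.exp_mul, mul_right_comm,
            div_mul_cancel₀ _ hq.ne']
  have hp : 0 < bracket r ^ p := Real.rpow_pos_of_pos (bracket_pos r) p
  rw [← ENNReal.ofReal, decay, ← ENNReal.ofReal_mul (by positivity)]
  refine ENNReal.ofReal_le_ofReal ?_
  rw [Real.rpow_neg (bracket_pos r).le, Real.exp_neg, ← div_eq_mul_inv, le_div_iff₀ hp,
    inv_mul_le_iff₀ (Real.exp_pos _)]
  linarith

lemma norm_le_sum_abs {ι : Type*} [Fintype ι] (ξ : EuclideanSpace ℝ ι) : ‖ξ‖ ≤ ∑ i, |ξ i| := by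
  rw [EuclideanSpace.norm_eq]
  refine Real.sqrt_le_iff.2 ⟨Finset.sum_nonneg fun i _ => abs_nonneg _, ?_⟩
  simp only [Real.norm_eq_abs]
  exact Finset.sum_sq_le_sq_sum_of_nonneg fun i _ => abs_nonneg _

lemma lintegral_expWeight_neg_mul_modulationDecay_lt_top (hh : Measurable h) (hσ : 0 < σ)
    (hb : 1 < b) : ∫⁻ ζ, expWeight (-σ) ζ * modulationDecay h s b ζ < ⊤ := by
  obtain ⟨E, hE⟩ := exists_ofReal_exp_neg_le_decay hσ ((d : ℝ) + 1 - s)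
  have hfin : ∫⁻ ξ : EuclideanSpace ℝ (Fin d), E * decay ((d : ℝ) + 1) ‖ξ‖ < ⊤ := by
    rw [lintegral_const_mul _ (by fun_prop)]
    exact ENNReal.mul_lt_top ENNReal.coe_lt_top (lintegral_decay_norm_lt_top volume (by simp))
  obtain ⟨C, hC⟩ := exists_lintegral_decay_modulation_mul_le (d := d) hb
  refine (lintegral_mono fun ζ => ?_).trans_lt ((hC h hh (fun z => E * decay ((d : ℝ) + 1) ‖z.2‖)
    (by fun_prop) _ fun _ => (ENNReal.coe_toNNReal hfin.ne).ge).trans_lt ENNReal.coe_lt_top)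
  have hexp : expWeight (-σ) ζ ≤ E * decay ((d : ℝ) + 1 - s) ‖spacePart ζ‖ := by
    refine le_trans ?_ (hE _ (norm_nonneg _))
    rw [expWeight, neg_mul]
    gcongr
    exact norm_le_sum_abs _
  calc expWeight (-σ) ζ * modulationDecay h s b ζ
      ≤ E * decay ((d : ℝ) + 1 - s) ‖spacePart ζ‖ *
          (decay s ‖spacePart ζ‖ * decay b (modulation h ζ)) := mul_le_mul_left hexp _
    _ = decay b (modulation h ζ) * (E * decay ((d : ℝ) + 1) ‖spacePart ζ‖) := by
        rw [← sub_add_cancel ((d : ℝ) + 1) s, ← decay_mul_decay, sub_add_cancel]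
        ring

/-- The exponential weight outweighs a negative `s`.  Integrability of the Fourier transforms makes
the elements of the spaces functions whose products correspond to convolutions. -/
lemma exists_integrable_isFunction_fourier (hh : Measurable h) (hσ : 0 < σ) (hb : 1 / 2 < b)
    {u : 𝓢'(SpaceTime d, ℂ)} (hu : gbNorm h σ s b u < ⊤) :
    ∃ F : SpaceTime d → ℂ, Measurable F ∧ Integrable F ∧ IsFunction F (𝓕 u) := by
  obtain ⟨F₀, hF₀, -⟩ := by simpa only [gbNorm, iInf_lt_iff] using hu
  have hm := hF₀.locallyIntegrable.aestronglyMeasurable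
  set F := hm.mk F₀
  have hFm : Measurable F := hm.stronglyMeasurable_mk.measurable
  have hF : IsFunction F (𝓕 u) := hF₀.congr hm.ae_eq_mk
  refine ⟨F, hFm, ?_, hF⟩
  rw [gbNorm_eq_eLpNorm_gbDensity hF] at hu
  have hr : (2 * Real.pi)⁻¹ ≠ 0 := by positivity
  rw [← integrable_comp_smul_iff volume _ hr]
  refine ⟨(hFm.comp (measurable_const_smul _)).aestronglyMeasurable, ?_⟩
  have hsplit : ∀ ζ, ‖F ((2 * Real.pi)⁻¹ • ζ)‖ₑ =
      expWeight (-σ) ζ * modulationDecay h s b ζ * gbDensity h σ s b F ζ := fun ζ => by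
    rw [mul_assoc, ← expWeight_mul_enorm, ← mul_assoc, expWeight_mul_expWeight, neg_add_cancel,
      expWeight_zero, one_mul]
  have hsq := sq_lintegral_mul_le (μ := volume)
    (f := fun ζ => expWeight (-σ) ζ * modulationDecay h s b ζ) (g := gbDensity h σ s b F)
    (by fun_prop) (by fun_prop)
  have hweight : ∫⁻ ζ, (expWeight (-σ) ζ * modulationDecay h s b ζ) ^ 2 < ⊤ := by
    have h2 := lintegral_expWeight_neg_mul_modulationDecay_lt_top (s := 2 * s) (b := 2 * b) hh
      (add_pos hσ hσ) (by linarith)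
    simpa only [mul_pow, modulationDecay_sq, sq (expWeight _ _), expWeight_mul_expWeight,
      ← neg_add] using h2
  have hdensity : ∫⁻ ζ, gbDensity h σ s b F ζ ^ 2 < ⊤ := by
    have h2 := ENNReal.pow_lt_top hu (n := 2)
    rwa [eLpNorm_two_sq] at h2
  simp only [HasFiniteIntegral, hsplit]
  exact (ENNReal.pow_lt_top_iff.1
    (hsq.trans_lt (ENNReal.mul_lt_top hweight hdensity))).resolve_right two_ne_zero

end FourierIntegrability

section Products

variable {d : ℕ} {h h₁ h₂ h₃ : EuclideanSpace ℝ (Fin d) → ℝ} {σ s s₁ s₂ s₃ b b₁ b₂ b₃ : ℝ}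
  {u v : 𝓢'(SpaceTime d, ℂ)}

lemma gbDensity_mul_convolution_le (hσ : 0 ≤ σ) {F G : SpaceTime d → ℂ} (hF : Measurable F)
    (hG : Measurable G) (ζ : SpaceTime d) :
    gbDensity h₃ σ s₃ b₃ (F ⋆[ContinuousLinearMap.mul ℂ ℂ] G) ζ ≤
      modulationDecay h₃ (-s₃) (-b₃) ζ *
        ∫⁻ x, modulationDecay h₁ s₁ b₁ x * gbDensity h₁ σ s₁ b₁ F x *
          (modulationDecay h₂ s₂ b₂ (ζ - x) * gbDensity h₂ σ s₂ b₂ G (ζ - x)) := by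
  simp only [← expWeight_mul_enorm]
  rw [gbDensity, mul_comm (expWeight σ ζ), mul_assoc]
  gcongr
  have hr : (2 * Real.pi)⁻¹ ≤ 1 := inv_le_one_of_one_le₀ (by linarith [Real.pi_gt_three])
  calc expWeight σ ζ * ‖(F ⋆[ContinuousLinearMap.mul ℂ ℂ] G) ((2 * Real.pi)⁻¹ • ζ)‖ₑ
      ≤ expWeight σ ζ *
          ∫⁻ x, ‖F ((2 * Real.pi)⁻¹ • x)‖ₑ * ‖G ((2 * Real.pi)⁻¹ • (ζ - x))‖ₑ := by
        gcongr
        exact enorm_mul_convolution_smul_le (by positivity) hr hF hG ζ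
    _ = ∫⁻ x, expWeight σ ζ *
          (‖F ((2 * Real.pi)⁻¹ • x)‖ₑ * ‖G ((2 * Real.pi)⁻¹ • (ζ - x))‖ₑ) :=
        (lintegral_const_mul _ (by fun_prop)).symm
    _ ≤ _ := lintegral_mono fun x => by
        have hexp := expWeight_add_le hσ x (ζ - x)
        rw [add_sub_cancel] at hexp
        exact (mul_le_mul_left hexp _).trans_eq (mul_mul_mul_comm _ _ _ _)

theorem exists_isProduct_of_trilinearBound {C : ℝ≥0}
    (hT : TrilinearBound (modulationDecay h₁ s₁ b₁) (modulationDecay h₂ s₂ b₂)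
      (modulationDecay h₃ (-s₃) (-b₃)) C)
    (hh₁ : Measurable h₁) (hh₂ : Measurable h₂) (hh₃ : Measurable h₃) (hσ : 0 < σ)
    (hb₁ : 1 / 2 < b₁) (hb₂ : 1 / 2 < b₂) (hu : gbNorm h₁ σ s₁ b₁ u < ⊤)
    (hv : gbNorm h₂ σ s₂ b₂ v < ⊤) :
    ∃ w : 𝓢'(SpaceTime d, ℂ), IsProduct u v w ∧
      gbNorm h₃ σ s₃ b₃ w ≤ C * gbNorm h₁ σ s₁ b₁ u * gbNorm h₂ σ s₂ b₂ v := by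
  obtain ⟨F, hFm, hFi, hF⟩ := exists_integrable_isFunction_fourier hh₁ hσ hb₁ hu
  obtain ⟨G, hGm, hGi, hG⟩ := exists_integrable_isFunction_fourier hh₂ hσ hb₂ hv
  have hFG := hFi.integrable_convolution (ContinuousLinearMap.mul ℂ ℂ) hGi
  obtain ⟨w, hw⟩ := exists_isFunction_fourier hFG
  refine ⟨w, ⟨𝓕⁻ F, 𝓕⁻ G, hF.fourierInv hFi, hG.fourierInv hGi, ?_⟩, ?_⟩
  · exact (hw.fourierInv hFG).congr (Eventually.of_forall (fourierInv_mul_convolution_eq hFi hGi))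
  · rw [gbNorm_eq_eLpNorm_gbDensity hF, gbNorm_eq_eLpNorm_gbDensity hG,
      gbNorm_eq_eLpNorm_gbDensity hw]
    refine (eLpNorm_mono_enorm fun ζ => ?_).trans (hT.eLpNorm_convolution_le (by fun_prop)
      (by fun_prop) (by fun_prop) (measurable_gbDensity hh₁ hFm) (measurable_gbDensity hh₂ hGm))
    exact gbDensity_mul_convolution_le hσ.le hFm hGm ζ

lemma exists_conj (hh : Measurable h) (hσ : 0 < σ) (hb : 1 / 2 < b)
    (hv : gbNorm h σ s b v < ⊤) :
    ∃ v' : 𝓢'(SpaceTime d, ℂ), gbNorm (fun ξ => -h (-ξ)) σ s b v' = gbNorm h σ s b v ∧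
      ∀ u w : 𝓢'(SpaceTime d, ℂ), IsProduct u v' w → IsConjProduct u v w := by
  obtain ⟨G, hGm, hGi, hG⟩ := exists_integrable_isFunction_fourier hh hσ hb hv
  have hG'i : Integrable fun ζ => conj (G (-ζ)) :=
    (LinearIsometryEquiv.integrable_comp_iff Complex.conjLIE).2 hGi.comp_neg
  obtain ⟨v', hv'⟩ := exists_isFunction_fourier hG'i
  refine ⟨v', ?_, fun u w ⟨f, g, hf, hg, hfg⟩ => ?_⟩
  · rw [gbNorm_eq_eLpNorm_gbDensity hv', gbNorm_eq_eLpNorm_gbDensity hG,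
      gbDensity_neg_comp_neg]
    exact eLpNorm_comp_measurePreserving (measurable_gbDensity hh hGm).aestronglyMeasurable
      (Measure.measurePreserving_neg volume)
  · refine ⟨f, 𝓕⁻ G, hf, hG.fourierInv hGi, hfg.congr ?_⟩
    filter_upwards [hg.ae_eq (hv'.fourierInv hG'i)] with z hz
    rw [hz, conj_fourierInv]

theorem exists_isConjProduct_of_trilinearBound {C : ℝ≥0}
    (hT : TrilinearBound (modulationDecay h₁ s₁ b₁) (fun ζ => modulationDecay h₂ s₂ b₂ (-ζ))
      (modulationDecay h₃ (-s₃) (-b₃)) C)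
    (hh₁ : Measurable h₁) (hh₂ : Measurable h₂) (hh₃ : Measurable h₃) (hσ : 0 < σ)
    (hb₁ : 1 / 2 < b₁) (hb₂ : 1 / 2 < b₂) (hu : gbNorm h₁ σ s₁ b₁ u < ⊤)
    (hv : gbNorm h₂ σ s₂ b₂ v < ⊤) :
    ∃ w : 𝓢'(SpaceTime d, ℂ), IsConjProduct u v w ∧
      gbNorm h₃ σ s₃ b₃ w ≤ C * gbNorm h₁ σ s₁ b₁ u * gbNorm h₂ σ s₂ b₂ v := by
  obtain ⟨v', hv', hconj⟩ := exists_conj hh₂ hσ hb₂ hv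
  simp only [← modulationDecay_neg_comp_neg] at hT
  obtain ⟨w, hw, hwC⟩ := exists_isProduct_of_trilinearBound hT hh₁ (by fun_prop) hh₃ hσ hb₁ hb₂ hu
    (hv'.trans_lt hv)
  exact ⟨w, hconj u w hw, hv' ▸ hwC⟩

lemma lipschitzWith_wave {ε : ℝ} {K : ℝ≥0} (hε : |ε| ≤ K) :
    LipschitzWith K (wave (d := d) ε) := by
  refine LipschitzWith.of_dist_le_mul fun x y => ?_
  rw [wave, wave, dist_neg_neg, Real.dist_eq, ← mul_sub, abs_mul, dist_eq_norm]
  exact mul_le_mul hε (abs_norm_sub_norm_le x y) (abs_nonneg _) K.2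

theorem lemma4p1_general {d : ℕ} (hd : d ≤ 3) {s b b' : ℝ} (hb : 1 / 2 < b) (hbb' : b ≤ b')
    (hb'd : b' < (6 + 2 * s - d) / 4) (hb'1 : b' < 1) (hb's : b' < s + 1) (K : ℝ≥0) :
    ∃ C : ℝ, 0 < C ∧ ∀ σ : ℝ, 0 < σ → ∀ h : EuclideanSpace ℝ (Fin d) → ℝ, LipschitzWith K h →
      (∀ f g : 𝓢'(SpaceTime d, ℂ),
        gbNorm schrodinger σ 0 b f < ⊤ → gbNorm h σ s b g < ⊤ →
        ∃ fg : 𝓢'(SpaceTime d, ℂ), IsProduct f g fg ∧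
          gbNorm schrodinger σ 0 (b' - 1) fg ≤
            ENNReal.ofReal C * gbNorm schrodinger σ 0 b f * gbNorm h σ s b g) ∧
      (∀ f g : 𝓢'(SpaceTime d, ℂ),
        gbNorm schrodinger σ 0 b f < ⊤ → gbNorm schrodinger σ 0 b g < ⊤ →
        ∃ fg : 𝓢'(SpaceTime d, ℂ), IsConjProduct f g fg ∧
          gbNorm h σ (-s) (b' - 1) fg ≤
            ENNReal.ofReal C * gbNorm schrodinger σ 0 b f * gbNorm schrodinger σ 0 b g) := by
  obtain ⟨C₁, hC₁⟩ := exists_trilinearBound_schrodinger_output hd hb hbb' hb'd hb'1 hb's K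
  obtain ⟨C₂, hC₂⟩ := exists_trilinearBound_phase_output hd hb hbb' hb'd hb'1 hb's K
  have hle₁ : (C₁ : ℝ≥0∞) ≤ ENNReal.ofReal (C₁ + C₂ + 1) := by
    rw [← ENNReal.ofReal_coe_nnreal]
    exact ENNReal.ofReal_le_ofReal (by linarith [C₂.2])
  have hle₂ : (C₂ : ℝ≥0∞) ≤ ENNReal.ofReal (C₁ + C₂ + 1) := by
    rw [← ENNReal.ofReal_coe_nnreal]
    exact ENNReal.ofReal_le_ofReal (by linarith [C₁.2])
  refine ⟨C₁ + C₂ + 1, by positivity, fun σ hσ h hh => ?_⟩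
  have hhm := hh.continuous.measurable
  have hSm := (continuous_schrodinger (d := d)).measurable
  constructor
  · intro f g hf hg
    obtain ⟨fg, hfg, hfgC⟩ := exists_isProduct_of_trilinearBound (s₃ := 0) (b₃ := b' - 1)
      (by simpa only [neg_zero, neg_sub] using hC₁ h hh) hSm hhm hSm hσ hb hb hf hg
    exact ⟨fg, hfg, hfgC.trans (by gcongr)⟩
  · intro f g hf hg
    have hT := (hC₂ h hh).rotate (by fun_prop) (by fun_prop) (by fun_prop)
    obtain ⟨fg, hfg, hfgC⟩ := exists_isConjProduct_of_trilinearBound (s₃ := -s) (b₃ := b' - 1)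
      (by simpa only [neg_neg, neg_sub] using hT) hSm hSm hhm hσ hb hb hf hg
    exact ⟨fg, hfg, hfgC.trans (by gcongr)⟩

end Products

end GevreyBourgain

end

/-- The constant `C` depends only on `d`, `s`, `b`, `b'`.  Each estimate includes that the product
of two elements of the given spaces exists as a tempered distribution. -/
theorem lemma4p1 (d : ℕ) (hd : d = 1 ∨ d = 2 ∨ d = 3) (s b b' : ℝ) (hs : -1 / 2 < s)
    (hb : 1 / 2 < b) (hbb' : b ≤ b')
    (hb' : b' < min (min ((6 + 2 * s - (d : ℝ)) / 4) 1) (s + 1)) :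
    ∃ C : ℝ, 0 < C ∧ ∀ σ : ℝ, 0 < σ → ∀ ε : ℝ, (ε = 1 ∨ ε = -1) →
      (∀ f g : 𝓢'(SpaceTime d, ℂ),
        gbNorm schrodinger σ 0 b f < ⊤ → gbNorm (wave ε) σ s b g < ⊤ →
        ∃ fg : 𝓢'(SpaceTime d, ℂ), IsProduct f g fg ∧
          gbNorm schrodinger σ 0 (b' - 1) fg ≤
            ENNReal.ofReal C * gbNorm schrodinger σ 0 b f * gbNorm (wave ε) σ s b g) ∧
      (∀ f g : 𝓢'(SpaceTime d, ℂ),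
        gbNorm schrodinger σ 0 b f < ⊤ → gbNorm schrodinger σ 0 b g < ⊤ →
        ∃ fg : 𝓢'(SpaceTime d, ℂ), IsConjProduct f g fg ∧
          gbNorm (wave ε) σ (-s) (b' - 1) fg ≤
            ENNReal.ofReal C * gbNorm schrodinger σ 0 b f * gbNorm schrodinger σ 0 b g) := by
  rw [lt_min_iff, lt_min_iff] at hb'
  obtain ⟨⟨hb'd, hb'1⟩, hb's⟩ := hb'
  obtain ⟨C, hC, H⟩ := lemma4p1_general (by omega) hb hbb' hb'd hb'1 hb's 1
  exact ⟨C, hC, fun σ hσ ε hε => H σ hσ (wave ε)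
    (lipschitzWith_wave (by rcases hε with rfl | rfl <;> simp))⟩
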